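/- Let $d\ge 1$ and $s\ge 0$ be integers, let $G\subset\mathbb{R}^d$ be a bounded set with Borel $\sigma$-algebra $\mathcal{B}(G)$, and let $\pi,\nu$ be probability measures on $(G,\mathcal{B}(G))$ such that $\nu$ has a density $\frac{d\nu}{d\pi}\in L_2=L_2(\pi)$. Let $K$ be a transition kernel on $(G,\mathcal{B}(G))$ that is reversible with respect to $\pi$, i.e. $\int_A K(x,B)\,\pi(dx)=\int_B K(x,A)\,\pi(dx)$ for all $A,B\in\mathcal{B}(G)$. Let $P f(x)=\int_G f(y)\,K(x,dy)$ be its Markov operator, let $L_2^0=\{f\in L_2:\int_G f\,d\pi=0\}$, and put $$\Lambda=\sup\{\lambda\in\operatorname{spec}(P\colon L_2^0\to L_2^0)\},\qquad \Lambda_0=\max\{\Lambda,0\}$$ (with $\Lambda_0=0$ if $L_2^0=\{0\}$). Assume that $K$ is variance bounding, i.e. $\Lambda<1$. Let $\varphi\colon G\times[0,1]^s\to G$ be any update function of $K$, i.e. a measurable function such that $K(x,A)=\lambda_s(\{u\in[0,1]^s:\varphi(x;u)\in A\})$ for all $x\in G$, $A\in\mathcal{B}(G)$, where $\lambda_s$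 is Lebesgue measure, and let $\psi\colon[0,1]^s\to G$ be any generator function of $\nu$, i.e. a measurable function such that $\nu(A)=\lambda_s(\{u\in[0,1]^s:\psi(u)\in A\})$ for all $A\in\mathcal{B}(G)$. For a driver sequence $u_0,\dots,u_{n-1}\in[0,1]^s$ let $S_n=(x_1,\dots,x_n)$ be given by $x_1=\psi(u_0)$ and $x_{i+1}=\varphi(x_i;u_i)$ for $i=1,\dots,n-1$. Let $\mathscr{B}=\{(-\infty,x)\cap G: x\in\mathbb{R}^d\}$ with $(-\infty,x)=\prod_{j=1}^d(-\infty,x_j)$, and let $$D^*_{\mathscr{B},\pi}(S_n)=\sup_{A\in\mathscr{B}}\Big|\frac1n\sum_{i=1}^n 1_{x_i\in A}-\pi(A)\Big|.$$ Then for every $n\ge 16$ there exists a driver sequence $u_0,\dots,u_{n-1}\in[0,1]^s$ such that $$D^*_{\mathscr{B},\pi}(S_n)\le\sqrt{\frac{1+\Lambda_0}{1-\Lambda_0}}\cdot\frac{\sqrt2\,\big(\log\|\frac{d\nu}{d\pi}\|_2+d\log n+3d^2\log(5d)\big)^{1/2}}{\sqrt n}+\frac{8}{n^{3/4}},$$ where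 $\|\cdot\|_2$ is the norm of $L_2(\pi)$. In particular, one can choose for each $n$ a driver sequence of length $n$ such that $D^*_{\mathscr{B},\pi}(S_n)=\mathcal{O}(n^{-1/2}(\log n)^{1/2})$ as $n\to\infty$. -/

import Mathlib

open MeasureTheory ProbabilityTheory
open scoped ENNReal

noncomputable section

namespace MCQMC

section MarkovOperator

variable {α : Type*} [MeasurableSpace α]

/-- The action of a kernel on functions: `(P f)(x) = ∫ f(y) K(x, dy)`. -/
def kernelAct (K : Kernel α α) (f : α → ℝ) : α → ℝ := fun x => ∫ y, f y ∂(K x)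

lemma lintegral_kernel {K : Kernel α α} {π : Measure α} (h : K.Invariant π)
    {g : α → ℝ≥0∞} (hg : Measurable g) :
    ∫⁻ x, ∫⁻ y, g y ∂(K x) ∂π = ∫⁻ x, g x ∂π := by
  conv_rhs => rw [← h.def]
  exact (Measure.lintegral_bind K.aemeasurable hg.aemeasurable).symm

lemma ae_kernel {K : Kernel α α} {π : Measure α} (h : K.Invariant π)
    {p : α → Prop} (hp : ∀ᵐ x ∂π, p x) : ∀ᵐ x ∂π, ∀ᵐ y ∂(K x), p y := by
  rw [← h.def] at hp
  exact Measure.ae_ae_of_ae_comp hp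

lemma kernelAct_congr {K : Kernel α α} {π : Measure α} (h : K.Invariant π)
    {f g : α → ℝ} (hfg : f =ᵐ[π] g) : kernelAct K f =ᵐ[π] kernelAct K g := by
  filter_upwards [ae_kernel h hfg] with x hx
  exact integral_congr_ae hx

lemma eLpNorm_two_sq (f : α → ℝ) (μ : Measure α) :
    eLpNorm f 2 μ ^ 2 = ∫⁻ x, ‖f x‖ₑ ^ 2 ∂μ := by
  have := eLpNorm_nnreal_pow_eq_lintegral (f := f) (μ := μ) (p := 2) (by norm_num)
  simpa using this

lemma eLpNorm_kernelAct_le {K : Kernel α α} [IsMarkovKernel K] {π : Measure α}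
    (h : K.Invariant π) {f : α → ℝ} (hf : StronglyMeasurable f) :
    eLpNorm (kernelAct K f) 2 π ≤ eLpNorm f 2 π := by
  have key : eLpNorm (kernelAct K f) 2 π ^ 2 ≤ eLpNorm f 2 π ^ 2 := by
    rw [eLpNorm_two_sq, eLpNorm_two_sq, ← lintegral_kernel h (hf.measurable.enorm.pow_const 2)]
    refine lintegral_mono fun x => ?_
    rw [← eLpNorm_two_sq]
    refine pow_le_pow_left' ?_ 2
    calc ‖kernelAct K f x‖ₑ ≤ ∫⁻ y, ‖f y‖ₑ ∂(K x) := enorm_integral_le_lintegral_enorm _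
      _ = eLpNorm f 1 (K x) := eLpNorm_one_eq_lintegral_enorm.symm
      _ ≤ eLpNorm f 2 (K x) :=
          eLpNorm_le_eLpNorm_of_exponent_le one_le_two hf.aestronglyMeasurable
  exact (ENNReal.pow_le_pow_left_iff two_ne_zero).1 key

lemma memLp_kernelAct {K : Kernel α α} [IsMarkovKernel K] {π : Measure α}
    (h : K.Invariant π) (f : Lp ℝ 2 π) : MemLp (kernelAct K f) 2 π :=
  ⟨(Lp.stronglyMeasurable f).integral_kernel.aestronglyMeasurable,
    (eLpNorm_kernelAct_le h (Lp.stronglyMeasurable f)).trans_lt (Lp.memLp f).2⟩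

lemma ae_integrable_kernel {K : Kernel α α} {π : Measure α} [IsFiniteMeasure π]
    (h : K.Invariant π) (f : Lp ℝ 2 π) : ∀ᵐ x ∂π, Integrable f (K x) := by
  have hf : Integrable f π := (Lp.memLp f).integrable one_le_two
  have h1 : ∫⁻ x, ∫⁻ y, ‖f y‖ₑ ∂(K x) ∂π ≠ ∞ := by
    rw [lintegral_kernel h (Lp.stronglyMeasurable f).measurable.enorm]
    exact hf.2.ne
  filter_upwards [ae_lt_top
    ((Lp.stronglyMeasurable f).measurable.enorm.lintegral_kernel (κ := K)) h1] with x hx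
  exact ⟨(Lp.stronglyMeasurable f).aestronglyMeasurable, hx⟩

/-- The Markov operator `P` of the kernel `K`, as a bounded operator on `L₂(π)`. -/
def markovOp (K : Kernel α α) [IsMarkovKernel K] (π : Measure α) [IsProbabilityMeasure π]
    (h : K.Invariant π) : Lp ℝ 2 π →L[ℝ] Lp ℝ 2 π :=
  LinearMap.mkContinuous
    { toFun := fun f => (memLp_kernelAct h f).toLp (kernelAct K f)
      map_add' := fun f g => by
        rw [← MemLp.toLp_add, MemLp.toLp_eq_toLp_iff]
        refine (kernelAct_congr h (Lp.coeFn_add f g)).trans ?_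
        filter_upwards [ae_integrable_kernel h f, ae_integrable_kernel h g] with x hf hg
        exact integral_add hf hg
      map_smul' := fun c f => by
        rw [RingHom.id_apply, ← MemLp.toLp_const_smul, MemLp.toLp_eq_toLp_iff]
        refine (kernelAct_congr h (Lp.coeFn_smul c f)).trans ?_
        exact Filter.Eventually.of_forall fun x => integral_const_mul c _ }
    1 (fun f => by
      rw [one_mul, Lp.norm_def, Lp.norm_def]
      refine ENNReal.toReal_mono (Lp.memLp f).2.ne ?_
      refine (eLpNorm_congr_ae (MemLp.coeFn_toLp (memLp_kernelAct h f))).trans_le ?_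
      exact eLpNorm_kernelAct_le h (Lp.stronglyMeasurable f))

lemma coeFn_markovOp (K : Kernel α α) [IsMarkovKernel K] (π : Measure α)
    [IsProbabilityMeasure π] (h : K.Invariant π) (f : Lp ℝ 2 π) :
    markovOp K π h f =ᵐ[π] fun x => ∫ y, f y ∂(K x) :=
  MemLp.coeFn_toLp (memLp_kernelAct h f)

/-- The subspace `L₂⁰(π)` of functions in `L₂(π)` with mean zero. -/
def L2Zero (π : Measure α) [IsProbabilityMeasure π] : Submodule ℝ (Lp ℝ 2 π) where
  carrier := {f | ∫ x, f x ∂π = 0}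
  zero_mem' := by
    simp only [Set.mem_ofPred_eq]
    rw [integral_congr_ae (Lp.coeFn_zero ℝ 2 π)]
    simp
  add_mem' := fun {f g} hf hg => by
    simp only [Set.mem_ofPred_eq] at hf hg ⊢
    rw [integral_congr_ae (Lp.coeFn_add f g)]
    have := integral_add ((Lp.memLp f).integrable one_le_two)
      ((Lp.memLp g).integrable one_le_two)
    simp only [Pi.add_apply]
    rw [this, hf, hg, add_zero]
  smul_mem' := fun c f hf => by
    simp only [Set.mem_ofPred_eq] at hf ⊢
    rw [integral_congr_ae (Lp.coeFn_smul c f)]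
    simp only [Pi.smul_apply]
    rw [integral_smul, hf, smul_zero]

lemma markovOp_mem_L2Zero {K : Kernel α α} [IsMarkovKernel K] {π : Measure α}
    [IsProbabilityMeasure π] (h : K.Invariant π) {f : Lp ℝ 2 π} (hf : f ∈ L2Zero π) :
    markovOp K π h f ∈ L2Zero π := by
  change ∫ x, markovOp K π h f x ∂π = 0
  change ∫ x, f x ∂π = 0 at hf
  rw [integral_congr_ae (coeFn_markovOp K π h f)]
  have hc : (K ∘ₖ Kernel.const Unit π) () = π := by
    rw [← Measure.comp_eq_comp_const_apply]
    exact h.def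
  have hi : Integrable f ((K ∘ₖ Kernel.const Unit π) ()) := by
    rw [hc]
    exact (Lp.memLp f).integrable one_le_two
  have := Kernel.integral_comp hi
  rw [hc, Kernel.const_apply] at this
  rw [← this, hf]

/-- The Markov operator restricted to mean-zero functions, `P : L₂⁰ → L₂⁰`. -/
def markovOpZero (K : Kernel α α) [IsMarkovKernel K] (π : Measure α) [IsProbabilityMeasure π]
    (h : K.Invariant π) : L2Zero π →L[ℝ] L2Zero π :=
  ((markovOp K π h).comp (L2Zero π).subtypeL).codRestrict (L2Zero π)
    (fun f => markovOp_mem_L2Zero h f.2)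

/-- `Λ = sup {λ ∈ spec(P | L₂⁰)}`. The spectrum is a bounded set of reals; it is empty only when
`L₂⁰ = {0}`, where the convention `sup ∅ = 0` still gives the intended `max(Λ, 0) = 0`. -/
def spectralSup (K : Kernel α α) [IsMarkovKernel K] (π : Measure α) [IsProbabilityMeasure π]
    (h : K.IsReversible π) : ℝ :=
  sSup (spectrum ℝ (markovOpZero K π h.invariant))

/-- A reversible kernel is variance bounding if `Λ < 1`. -/
def IsVarianceBounding (K : Kernel α α) [IsMarkovKernel K] (π : Measure α)
    [IsProbabilityMeasure π] (h : K.IsReversible π) : Prop :=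
  spectralSup K π h < 1

/-- `dν/dπ ∈ L₂(π)`: `ν` has a density with respect to `π`, and it is square integrable. -/
def HasL2Density (ν π : Measure α) : Prop :=
  ν ≪ π ∧ MemLp (fun x => (ν.rnDeriv π x).toReal) 2 π

/-- `‖dν/dπ‖₂`. -/
def densityNorm (ν π : Measure α) : ℝ :=
  (eLpNorm (fun x => (ν.rnDeriv π x).toReal) 2 π).toReal

end MarkovOperator

section Driver

/-- The cube `[0,1]^s`; its `volume` is the uniform distribution. -/
abbrev Cube (s : ℕ) : Type := Fin s → unitInterval

variable {α : Type*} [MeasurableSpace α] {s : ℕ}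

/-- `φ` is an update function of the kernel `K`: `K(x, A) = λ_s {u | φ(x; u) ∈ A}`. -/
def IsUpdateFunction (φ : α → Cube s → α) (K : Kernel α α) : Prop :=
  Measurable (Function.uncurry φ) ∧
    ∀ x A, MeasurableSet A → K x A = volume {u : Cube s | φ x u ∈ A}

/-- `ψ` is a generator function of `ν`: `ν(A) = λ_s {u | ψ(u) ∈ A}`. -/
def IsGeneratorFunction (ψ : Cube s → α) (ν : Measure α) : Prop :=
  Measurable ψ ∧ ∀ A, MeasurableSet A → ν A = volume {u : Cube s | ψ u ∈ A}

/-- `drivenState φ ψ u i _` is the state `x_{i+1}`: `x_1 = ψ(u_0)`, `x_{i+1} = φ(x_i; u_i)`. -/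
def drivenState (φ : α → Cube s → α) (ψ : Cube s → α) {n : ℕ} (u : Fin n → Cube s) :
    (i : ℕ) → i < n → α
  | 0, h => ψ (u ⟨0, h⟩)
  | i + 1, h => φ (drivenState φ ψ u i (Nat.lt_of_succ_lt h)) (u ⟨i + 1, h⟩)

/-- The points `S_n = (x_1, …, x_n)`, counted with multiplicity, generated by the driver sequence
`u_0, …, u_{n-1}`. -/
def drivenPoints (φ : α → Cube s → α) (ψ : Cube s → α) {n : ℕ} (u : Fin n → Cube s) :
    Fin n → α :=
  fun i => drivenState φ ψ u i i.isLt

/-- The star-discrepancy `sup_{A ∈ 𝒜} |(1/n) ∑ 1_{x_i ∈ A} - π(A)|`. -/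
def starDiscrepancy (𝒜 : Set (Set α)) (π : Measure α) {n : ℕ} (x : Fin n → α) : ℝ :=
  ⨆ A : 𝒜, |(1 / (n : ℝ)) * ∑ i, (A : Set α).indicator (fun _ => (1 : ℝ)) (x i)
    - π.real (A : Set α)|

/-- The boxes `(-∞, x) ∩ G`, `x ∈ ℝ^d`, as subsets of `G`. -/
def anchoredBoxes {d : ℕ} (G : Set (Fin d → ℝ)) : Set (Set G) :=
  {A | ∃ x : Fin d → ℝ, A = {y : G | ∀ j, (y : Fin d → ℝ) j < x j}}

end Driver

end MCQMC

end

/-! A probabilistic existence argument. Under uniform drivers the points form the chain with kernel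
`K` started from `ν`. The anchored boxes are bracketed by `k ^ d` pairs `L ⊆ U` with `π (U \ L) ≤ d
/ k`, so it suffices to control the upper deviations of each `U` and each `Lᶜ`. A Hoeffding
inequality (`measure_visits_ge_le`) bounds the probability of each such deviation; if these bounds
sum to less than one, some driver sequence avoids all the bad events.

For the Hoeffding inequality put `V = exp (t (1_A - π A) - S)`. The expectation of `∏ V(x_i)` over a
path is `∫ (V P)^(n-1) V dν`. If `⟨w, P w⟩ ≤ ∫ w² / V dπ` for every `w`, then `w ↦ V · P w` is a
contraction of `L₂(π / V)`, and this expectation is at most `e ‖dν/dπ‖₂` whatever the length of the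
path. The form inequality follows from `P ≤ Π + Λ (1 - Π)`, with `Π` the projection to constants, by
weighted Cauchy–Schwarz and a scalar inequality for the two values of `V` (`two_point_le_one`). Only
the upper edge of the spectrum enters: since `P` preserves positivity, `-⟨v, P v⟩ ≤ ⟨|v|, P |v|⟩`,
so the lower edge needs no separate bound. -/

namespace MCQMC

/-! ### Numerical range and spectrum of a symmetric operator on a real Hilbert space. -/

section Spectrum

variable {E : Type*} [NormedAddCommGroup E] [InnerProductSpace ℝ E]

/-- Cauchy–Schwarz for the form of a positive operator. -/
lemma norm_sq_le_of_symmetric_nonneg (S : E →L[ℝ] E)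
    (hS : (S : E →ₗ[ℝ] E).IsSymmetric) (hpos : ∀ x, 0 ≤ inner ℝ (S x) x) (x : E) :
    ‖S x‖ ^ 2 ≤ (‖S‖ + 1) * inner ℝ (S x) x := by
  have hM : 0 < ‖S‖ + 1 := by positivity
  set M := ‖S‖ + 1 with hMdef
  -- A gradient step of length `M⁻¹` on the form; the `+ 1` in `M` keeps it invertible when `S = 0`.
  have h1 := hpos (x - M⁻¹ • S x)
  have h2 : inner ℝ (S (S x)) x = ‖S x‖ ^ 2 := by
    rw [← real_inner_self_eq_norm_sq]
    exact hS (S x) x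
  have h3 : inner ℝ (S (S x)) (S x) ≤ M * ‖S x‖ ^ 2 := by
    refine (real_inner_le_norm _ _).trans ?_
    have := S.le_opNorm (S x)
    nlinarith [norm_nonneg (S x), sq_nonneg ‖S x‖]
  have h4 : inner ℝ (S (x - M⁻¹ • S x)) (x - M⁻¹ • S x) =
      inner ℝ (S x) x - 2 * M⁻¹ * ‖S x‖ ^ 2 + M⁻¹ ^ 2 * inner ℝ (S (S x)) (S x) := by
    simp only [map_sub, map_smul, inner_sub_left, inner_sub_right, real_inner_smul_left,
      real_inner_smul_right, h2, real_inner_self_eq_norm_sq]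
    ring
  rw [h4] at h1
  have h5 : M⁻¹ ^ 2 * inner ℝ (S (S x)) (S x) ≤ M⁻¹ * ‖S x‖ ^ 2 := by
    calc M⁻¹ ^ 2 * inner ℝ (S (S x)) (S x) ≤ M⁻¹ ^ 2 * (M * ‖S x‖ ^ 2) := by gcongr
      _ = M⁻¹ * ‖S x‖ ^ 2 := by field_simp
  have h6 : M⁻¹ * ‖S x‖ ^ 2 ≤ inner ℝ (S x) x := by linarith
  calc ‖S x‖ ^ 2 = M * (M⁻¹ * ‖S x‖ ^ 2) := by field_simp
    _ ≤ M * inner ℝ (S x) x := by gcongr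

/-- The numerical range of a symmetric operator lies below the supremum of its spectrum. -/
theorem inner_le_sSup_spectrum [CompleteSpace E] (T : E →L[ℝ] E)
    (hT : (T : E →ₗ[ℝ] E).IsSymmetric) (x : E) :
    inner ℝ (T x) x ≤ sSup (spectrum ℝ T) * ‖x‖ ^ 2 := by
  by_contra! hx
  have hx0 : x ≠ 0 := by
    rintro rfl
    simp at hx
  set R : Set ℝ := (fun y : E => inner ℝ (T y) y) '' Metric.sphere 0 1 with hR
  have hRb : BddAbove R := by
    refine ⟨‖T‖, ?_⟩
    rintro _ ⟨y, hy, rfl⟩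
    have hy1 : ‖y‖ = 1 := by simpa using hy
    have h1 := real_inner_le_norm (T y) y
    have h2 := T.le_opNorm y
    rw [hy1, mul_one] at h1 h2
    exact h1.trans h2
  have hle : ∀ y, inner ℝ (T y) y ≤ sSup R * ‖y‖ ^ 2 := by
    intro y
    rcases eq_or_ne y 0 with rfl | hy
    · simp
    have hy' : 0 < ‖y‖ := norm_pos_iff.2 hy
    have : inner ℝ (T (‖y‖⁻¹ • y)) (‖y‖⁻¹ • y) ≤ sSup R := by
      refine le_csSup hRb ⟨_, ?_, rfl⟩
      simp [norm_smul, hy'.ne']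
    rw [map_smul, real_inner_smul_left, real_inner_smul_right] at this
    calc inner ℝ (T y) y = (‖y‖⁻¹ * (‖y‖⁻¹ * inner ℝ (T y) y)) * ‖y‖ ^ 2 := by field_simp
      _ ≤ _ := by gcongr
  have hlt : sSup (spectrum ℝ T) < sSup R := by
    have h1 := hx.trans_le (hle x)
    exact lt_of_mul_lt_mul_right h1 (by positivity)
  have hbdd : BddAbove (spectrum ℝ T) :=
    ⟨‖T‖ * ‖(1 : E →L[ℝ] E)‖, fun k hk =>
      (le_abs_self k).trans (spectrum.norm_le_norm_mul_of_mem hk)⟩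
  -- So `sSup R - T` is nonnegative and invertible. Such a form is coercive, which keeps `R` at a
  -- positive distance below its own supremum.
  have hnot : sSup R ∉ spectrum ℝ T := fun h => (le_csSup hbdd h).not_gt hlt
  rw [spectrum.notMem_iff] at hnot
  set S : E →L[ℝ] E := algebraMap ℝ (E →L[ℝ] E) (sSup R) - T with hS
  have hSapp : ∀ y, S y = sSup R • y - T y := fun y => by
    simp [hS, Algebra.algebraMap_eq_smul_one]
  have hSsymm : (S : E →ₗ[ℝ] E).IsSymmetric := by
    intro y z
    change inner ℝ (S y) z = inner ℝ y (S z)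
    have := hT y z
    change inner ℝ (T y) z = inner ℝ y (T z) at this
    rw [hSapp, hSapp, inner_sub_left, inner_sub_right, this, real_inner_smul_left,
      real_inner_smul_right]
  have hSin : ∀ y, inner ℝ (S y) y = sSup R * ‖y‖ ^ 2 - inner ℝ (T y) y := by
    intro y
    rw [hSapp, inner_sub_left, real_inner_smul_left, real_inner_self_eq_norm_sq]
  have hSpos : ∀ y, 0 ≤ inner ℝ (S y) y := fun y => by
    rw [hSin]
    linarith [hle y]
  obtain ⟨U, hU⟩ := hnot
  set B : E →L[ℝ] E := ((U⁻¹ : (E →L[ℝ] E)ˣ) : E →L[ℝ] E) with hB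
  have hBS : ∀ y, B (S y) = y := fun y => by
    have : B * S = 1 := by rw [← hU, hB]; simp
    simpa using congrArg (fun A : E →L[ℝ] E => A y) this
  set c : ℝ := ((‖B‖ + 1) ^ 2 * (‖S‖ + 1))⁻¹ with hc
  have hcpos : 0 < c := by positivity
  have hlow : ∀ y, c * ‖y‖ ^ 2 ≤ inner ℝ (S y) y := by
    intro y
    have h1 : ‖y‖ ≤ (‖B‖ + 1) * ‖S y‖ := by
      calc ‖y‖ = ‖B (S y)‖ := by rw [hBS]
        _ ≤ ‖B‖ * ‖S y‖ := B.le_opNorm _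
        _ ≤ _ := by gcongr; linarith
    have h2 := norm_sq_le_of_symmetric_nonneg S hSsymm hSpos y
    have h3 : ‖y‖ ^ 2 ≤ (‖B‖ + 1) ^ 2 * ((‖S‖ + 1) * inner ℝ (S y) y) := by
      calc ‖y‖ ^ 2 ≤ ((‖B‖ + 1) * ‖S y‖) ^ 2 := by gcongr
        _ = (‖B‖ + 1) ^ 2 * ‖S y‖ ^ 2 := by ring
        _ ≤ _ := by gcongr
    rw [hc, inv_mul_le_iff₀ (by positivity)]
    linarith
  have hne : R.Nonempty := ⟨_, ‖x‖⁻¹ • x, by simp [norm_smul, hx0], rfl⟩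
  have : sSup R ≤ sSup R - c := by
    refine csSup_le hne ?_
    rintro _ ⟨y, hy, rfl⟩
    have hy1 : ‖y‖ = 1 := by simpa using hy
    have := hlow y
    rw [hSin, hy1] at this
    simp only
    linarith
  linarith

end Spectrum

/-! ### Reversibility as symmetry of the Markov operator. -/

section Reversible

lemma norm_toLp_sq {α : Type*} [MeasurableSpace α] {μ : Measure α} {w : α → ℝ} (hw : MemLp w 2 μ) :
    ‖hw.toLp w‖ ^ 2 = ∫ x, w x ^ 2 ∂μ := by
  rw [← real_inner_self_eq_norm_sq, L2.inner_def]
  refine integral_congr_ae ?_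
  filter_upwards [hw.coeFn_toLp] with x hx
  simp [hx]

variable {α : Type*} [MeasurableSpace α] {K : Kernel α α} [IsMarkovKernel K] {π : Measure α}
  [IsProbabilityMeasure π]

lemma map_swap_compProd_of_isReversible (hK : K.IsReversible π) :
    (π ⊗ₘ K).map Prod.swap = π ⊗ₘ K := by
  refine Measure.ext_prod_iff.2 fun {s t} hs ht => ?_
  rw [Measure.map_apply measurable_swap (hs.prod ht), Set.preimage_swap_prod,
    Measure.compProd_apply_prod ht hs, Measure.compProd_apply_prod hs ht]
  exact hK ht hs

lemma fst_compProd_map : (π ⊗ₘ K).map Prod.fst = π := by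
  have := Measure.fst_compProd π K
  rwa [Measure.fst] at this

lemma snd_compProd_map (hK : K.Invariant π) : (π ⊗ₘ K).map Prod.snd = π := by
  have := Measure.snd_compProd π K
  rw [Measure.snd] at this
  rw [this]
  exact hK.def

lemma integrable_mul_compProd (hK : K.Invariant π) {u w : α → ℝ} (hu : MemLp u 2 π)
    (hw : MemLp w 2 π) : Integrable (fun z : α × α => u z.1 * w z.2) (π ⊗ₘ K) := by
  have h1 : MemLp (fun z : α × α => u z.1) 2 (π ⊗ₘ K) := by
    have hu' : MemLp u 2 ((π ⊗ₘ K).map Prod.fst) := by rwa [fst_compProd_map]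
    exact hu'.comp_of_map measurable_fst.aemeasurable
  have h2 : MemLp (fun z : α × α => w z.2) 2 (π ⊗ₘ K) := by
    have hw' : MemLp w 2 ((π ⊗ₘ K).map Prod.snd) := by rwa [snd_compProd_map hK]
    exact hw'.comp_of_map measurable_snd.aemeasurable
  exact h1.integrable_mul h2

/-- Writing the form over the law of two consecutive states turns symmetry into invariance under the
swap, and lets pointwise inequalities in `(x, y)` be integrated. -/
lemma integral_mul_kernelAct (hK : K.Invariant π) {u w : α → ℝ} (hu : MemLp u 2 π)
    (hw : MemLp w 2 π) :
    ∫ x, u x * kernelAct K w x ∂π = ∫ z, u z.1 * w z.2 ∂(π ⊗ₘ K) := by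
  rw [Measure.integral_compProd (integrable_mul_compProd hK hu hw)]
  simp only [kernelAct, integral_const_mul]

/-- The Markov operator of a reversible kernel is symmetric. -/
lemma integral_mul_kernelAct_comm (hK : K.IsReversible π) {u w : α → ℝ} (hu : MemLp u 2 π)
    (hw : MemLp w 2 π) :
    ∫ x, u x * kernelAct K w x ∂π = ∫ x, w x * kernelAct K u x ∂π := by
  rw [integral_mul_kernelAct hK.invariant hu hw, integral_mul_kernelAct hK.invariant hw hu]
  conv_rhs => rw [← map_swap_compProd_of_isReversible hK]
  have := integral_map_equiv (μ := π ⊗ₘ K) MeasurableEquiv.prodComm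
    (fun z : α × α => w z.1 * u z.2)
  refine Eq.trans ?_ this.symm
  refine integral_congr_ae (Filter.Eventually.of_forall fun z => ?_)
  simp [MeasurableEquiv.prodComm, mul_comm]

/-- The subspace is the orthogonal complement of the constant `1`. Closedness gives the completeness
that the spectral bound needs. -/
lemma isClosed_L2Zero : IsClosed (L2Zero π : Set (Lp ℝ 2 π)) := by
  have : (L2Zero π : Set (Lp ℝ 2 π)) =
      (fun f => inner ℝ (indicatorConstLp 2 MeasurableSet.univ (measure_ne_top π _) (1 : ℝ)) f)
        ⁻¹' {0} := by
    ext f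
    have := L2.inner_indicatorConstLp_one (𝕜 := ℝ) MeasurableSet.univ (measure_ne_top π _) f
    simp only [Set.mem_preimage, this, setIntegral_univ]
    rfl
  rw [this]
  exact isClosed_singleton.preimage (by fun_prop)

lemma isSymmetric_markovOpZero (hK : K.IsReversible π) :
    (markovOpZero K π hK.invariant : L2Zero π →ₗ[ℝ] L2Zero π).IsSymmetric := by
  intro f g
  change inner ℝ (markovOp K π hK.invariant f) (g : Lp ℝ 2 π) =
    inner ℝ (f : Lp ℝ 2 π) (markovOp K π hK.invariant g)
  rw [L2.inner_def, L2.inner_def]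
  have h1 : ∫ x, inner ℝ (markovOp K π hK.invariant f x) ((g : Lp ℝ 2 π) x) ∂π =
      ∫ x, (g : Lp ℝ 2 π) x * kernelAct K f x ∂π := by
    refine integral_congr_ae ?_
    filter_upwards [coeFn_markovOp K π hK.invariant f] with x hx
    simp [hx, kernelAct]
  have h2 : ∫ x, inner ℝ ((f : Lp ℝ 2 π) x) (markovOp K π hK.invariant g x) ∂π =
      ∫ x, (f : Lp ℝ 2 π) x * kernelAct K g x ∂π := by
    refine integral_congr_ae ?_
    filter_upwards [coeFn_markovOp K π hK.invariant g] with x hx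
    simp [hx, kernelAct, mul_comm]
  rw [h1, h2]
  exact integral_mul_kernelAct_comm hK (Lp.memLp _) (Lp.memLp _)

lemma integral_mul_kernelAct_le_of_integral_eq_zero (hK : K.IsReversible π) {w : α → ℝ}
    (hw : MemLp w 2 π) (hw0 : ∫ x, w x ∂π = 0) :
    ∫ x, w x * kernelAct K w x ∂π ≤ spectralSup K π hK * ∫ x, w x ^ 2 ∂π := by
  have : CompleteSpace (L2Zero π) := isClosed_L2Zero.completeSpace_coe
  have hmem : hw.toLp w ∈ L2Zero π := by
    change ∫ x, hw.toLp w x ∂π = 0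
    rw [integral_congr_ae hw.coeFn_toLp, hw0]
  have key := inner_le_sSup_spectrum _ (isSymmetric_markovOpZero hK) ⟨hw.toLp w, hmem⟩
  have hn : ‖(⟨hw.toLp w, hmem⟩ : L2Zero π)‖ ^ 2 = ∫ x, w x ^ 2 ∂π :=
    norm_toLp_sq hw
  have hi : inner ℝ (markovOpZero K π hK.invariant ⟨hw.toLp w, hmem⟩) ⟨hw.toLp w, hmem⟩ =
      ∫ x, w x * kernelAct K w x ∂π := by
    change inner ℝ (markovOp K π hK.invariant (hw.toLp w)) (hw.toLp w) = _
    rw [L2.inner_def]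
    refine integral_congr_ae ?_
    filter_upwards [hw.coeFn_toLp, coeFn_markovOp K π hK.invariant (hw.toLp w),
      kernelAct_congr hK.invariant hw.coeFn_toLp] with x hx hx2 hx3
    rw [hx2, hx, ← hx3]
    simp [kernelAct]
  rw [hn, hi] at key
  exact key

end Reversible

/-! ### A class of test functions stable under products, absolute values and `P`. -/

section BoundedMeasurable

variable {α : Type*} [MeasurableSpace α]

/-- Bounded measurable real functions. -/
def BddMeas (w : α → ℝ) : Prop := Measurable w ∧ ∃ C, ∀ x, |w x| ≤ C

namespace BddMeas

variable {u w : α → ℝ}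

lemma const (c : ℝ) : BddMeas (fun _ : α => c) := ⟨measurable_const, |c|, fun _ => le_rfl⟩

lemma add (hu : BddMeas u) (hw : BddMeas w) : BddMeas (fun x => u x + w x) := by
  obtain ⟨hu, C, hC⟩ := hu
  obtain ⟨hw, D, hD⟩ := hw
  exact ⟨hu.add hw, C + D, fun x => (abs_add_le _ _).trans (add_le_add (hC x) (hD x))⟩

lemma mul (hu : BddMeas u) (hw : BddMeas w) : BddMeas (fun x => u x * w x) := by
  obtain ⟨hu, C, hC⟩ := hu
  obtain ⟨hw, D, hD⟩ := hw
  refine ⟨hu.mul hw, C * D, fun x => ?_⟩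
  rw [abs_mul]
  exact mul_le_mul (hC x) (hD x) (abs_nonneg _) ((abs_nonneg _).trans (hC x))

lemma sub (hu : BddMeas u) (hw : BddMeas w) : BddMeas (fun x => u x - w x) := by
  simpa [sub_eq_add_neg] using hu.add ((const (-1)).mul hw)

lemma abs (hu : BddMeas u) : BddMeas (fun x => |u x|) := by
  obtain ⟨hu, C, hC⟩ := hu
  exact ⟨measurable_abs.comp hu, C, fun x => by simpa using hC x⟩

lemma sq (hu : BddMeas u) : BddMeas (fun x => u x ^ 2) := by
  simpa [pow_two] using hu.mul hu

lemma ite {A : Set α} (hA : MeasurableSet A) (a b : ℝ) [DecidablePred (· ∈ A)] :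
    BddMeas (fun x => if x ∈ A then a else b) := by
  refine ⟨Measurable.ite hA measurable_const measurable_const, |a| + |b|, fun x => ?_⟩
  dsimp only
  split_ifs
  · linarith [abs_nonneg b]
  · linarith [abs_nonneg a]

lemma memLp (hu : BddMeas u) (p : ℝ≥0∞) (μ : Measure α) [IsFiniteMeasure μ] : MemLp u p μ := by
  obtain ⟨hu, C, hC⟩ := hu
  exact MemLp.of_bound hu.aestronglyMeasurable C (Filter.Eventually.of_forall hC)

lemma integrable (hu : BddMeas u) (μ : Measure α) [IsFiniteMeasure μ] : Integrable u μ :=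
  memLp_one_iff_integrable.1 (hu.memLp 1 μ)

lemma kernelAct {K : Kernel α α} [IsMarkovKernel K] (hu : BddMeas u) :
    BddMeas (kernelAct K u) := by
  obtain ⟨hu, C, hC⟩ := hu
  refine ⟨(hu.stronglyMeasurable.integral_kernel (κ := K)).measurable, C, fun x => ?_⟩
  have := norm_integral_le_of_norm_le_const (μ := K x)
    (Filter.Eventually.of_forall fun y => (Real.norm_eq_abs (u y)).le.trans (hC y))
  simpa [MCQMC.kernelAct] using this

end BddMeas

lemma integral_ite_mem {A : Set α} (hA : MeasurableSet A) (μ : Measure α)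
    [IsProbabilityMeasure μ] (a b : ℝ) [DecidablePred (· ∈ A)] :
    ∫ x, (if x ∈ A then a else b) ∂μ = μ.real A * a + (1 - μ.real A) * b := by
  have h : (fun x => if x ∈ A then a else b) =
      fun x => b + A.indicator (fun _ => a - b) x := by
    funext x
    by_cases hx : x ∈ A <;> simp [hx]
  rw [h, integral_add (integrable_const b) ((integrable_const _).indicator hA),
    integral_indicator_const _ hA]
  simp
  ring

end BoundedMeasurable

/-! ### From the spectral bound to a contraction in a weighted `L₂` space. -/

section Contraction

variable {α : Type*} [MeasurableSpace α] {K : Kernel α α} [IsMarkovKernel K] {π : Measure α}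
  [IsProbabilityMeasure π]

/-- `P ≤ Π + Λ (1 - Π)` as quadratic forms, `Π` being the projection to constants. -/
lemma integral_mul_kernelAct_le (hK : K.IsReversible π) {Λ : ℝ} (hΛ : spectralSup K π hK ≤ Λ)
    {w : α → ℝ} (hw : BddMeas w) :
    ∫ x, w x * kernelAct K w x ∂π ≤ (1 - Λ) * (∫ x, w x ∂π) ^ 2 + Λ * ∫ x, w x ^ 2 ∂π := by
  set m := ∫ x, w x ∂π with hm
  have hv : BddMeas (fun x => w x - m) := hw.sub (.const m)
  have hv0 : ∫ x, (w x - m) ∂π = 0 := by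
    rw [integral_sub (hw.integrable π) (integrable_const m)]
    simp [hm]
  have h1 := integral_mul_kernelAct_le_of_integral_eq_zero hK (hv.memLp 2 π) hv0
  have hP : ∀ x, kernelAct K (fun x => w x - m) x = kernelAct K w x - m := fun x => by
    simp only [kernelAct]
    rw [integral_sub (hw.integrable _) (integrable_const m)]
    simp
  have hPm : ∫ x, kernelAct K w x ∂π = m := by
    have := integral_mul_kernelAct_comm hK ((BddMeas.const 1).memLp 2 π) (hw.memLp 2 π)
    simpa [kernelAct] using this
  have h2 : ∫ x, (w x - m) * kernelAct K (fun x => w x - m) x ∂π =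
      ∫ x, w x * kernelAct K w x ∂π - m ^ 2 := by
    have e : (fun x => (w x - m) * kernelAct K (fun x => w x - m) x) =
        fun x => w x * kernelAct K w x - m * kernelAct K w x - m * (w x - m) := by
      funext x
      rw [hP]
      ring
    have i1 := (hw.mul (hw.kernelAct (K := K))).integrable π
    have i2 := (hw.kernelAct (K := K)).integrable π
    have i3 : Integrable (fun x => w x * kernelAct K w x - m * kernelAct K w x) π :=
      i1.sub (i2.const_mul m)
    rw [e, integral_sub i3 ((hv.integrable π).const_mul m),
      integral_sub i1 (i2.const_mul m), integral_const_mul, integral_const_mul, hv0, hPm]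
    ring
  have h3 : ∫ x, (w x - m) ^ 2 ∂π = ∫ x, w x ^ 2 ∂π - m ^ 2 := by
    have e : (fun x => (w x - m) ^ 2) = fun x => w x ^ 2 - m * w x - m * (w x - m) := by
      funext x
      ring
    have i3 : Integrable (fun x => w x ^ 2 - m * w x) π :=
      (hw.sq.integrable π).sub ((hw.integrable π).const_mul m)
    rw [e, integral_sub i3 ((hv.integrable π).const_mul m), integral_sub (hw.sq.integrable π)
      ((hw.integrable π).const_mul m), integral_const_mul, integral_const_mul, hv0, ← hm]
    ring
  have h4 : 0 ≤ ∫ x, (w x - m) ^ 2 ∂π := integral_nonneg fun x => sq_nonneg _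
  have h5 := h1.trans (mul_le_mul_of_nonneg_right hΛ h4)
  rw [h2, h3] at h5
  linarith

/-- Weighted Cauchy–Schwarz, `(∫ w)² ≤ ∫ (r - Λ)⁻¹ · ∫ (r - Λ) w²`, absorbs the rank-one term `(1 -
Λ) (∫ w)²` once `(1 - Λ) ∫ (r - Λ)⁻¹ ≤ 1`. It is applied with `r = 1 / V`. -/
lemma integral_mul_kernelAct_le_weighted (hK : K.IsReversible π) {Λ : ℝ}
    (hΛ : spectralSup K π hK ≤ Λ) (hΛ1 : Λ < 1) {r : α → ℝ} (hr : BddMeas r)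
    (hpos : ∀ x, Λ < r x) (hinv : BddMeas fun x => (r x - Λ)⁻¹)
    (hint : (1 - Λ) * ∫ x, (r x - Λ)⁻¹ ∂π ≤ 1) {w : α → ℝ} (hw : BddMeas w) :
    ∫ x, w x * kernelAct K w x ∂π ≤ ∫ x, w x ^ 2 * r x ∂π := by
  refine (integral_mul_kernelAct_le hK hΛ hw).trans ?_
  set m := ∫ x, w x ∂π with hm
  set J := ∫ x, (r x - Λ)⁻¹ ∂π with hJ
  set s := (1 - Λ) * m with hs
  have h0 : 0 ≤ ∫ x, (r x - Λ) * (w x - s * (r x - Λ)⁻¹) ^ 2 ∂π :=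
    integral_nonneg fun x => mul_nonneg (sub_nonneg.2 (hpos x).le) (sq_nonneg _)
  have e : (fun x => (r x - Λ) * (w x - s * (r x - Λ)⁻¹) ^ 2) =
      fun x => w x ^ 2 * r x - Λ * w x ^ 2 - 2 * s * w x + s ^ 2 * (r x - Λ)⁻¹ := by
    funext x
    have : r x - Λ ≠ 0 := (sub_pos.2 (hpos x)).ne'
    field_simp
    ring
  have i1 := (hw.sq.mul hr).integrable π
  have i2 := (hw.sq.integrable π).const_mul Λ
  have i3 := (hw.integrable π).const_mul (2 * s)
  have i4 := (hinv.integrable π).const_mul (s ^ 2)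
  have i12 : Integrable (fun x => w x ^ 2 * r x - Λ * w x ^ 2) π := i1.sub i2
  have i123 : Integrable (fun x => w x ^ 2 * r x - Λ * w x ^ 2 - 2 * s * w x) π := i12.sub i3
  rw [e, integral_add i123 i4, integral_sub i12 i3, integral_sub i1 i2,
    integral_const_mul, integral_const_mul, integral_const_mul, ← hm, ← hJ] at h0
  have h1 : s ^ 2 * J ≤ (1 - Λ) * m ^ 2 := by
    calc s ^ 2 * J = ((1 - Λ) * m ^ 2) * ((1 - Λ) * J) := by rw [hs]; ring
      _ ≤ ((1 - Λ) * m ^ 2) * 1 :=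
        mul_le_mul_of_nonneg_left hint (mul_nonneg (by linarith) (sq_nonneg _))
      _ = _ := mul_one _
  have h2 : 2 * s * m = 2 * ((1 - Λ) * m ^ 2) := by rw [hs]; ring
  linarith

/-- Polarisation for a positivity preserving symmetric operator. -/
lemma integral_mul_kernelAct_le_half (hK : K.IsReversible π) {r : α → ℝ} (hr : BddMeas r)
    (hform : ∀ w : α → ℝ, BddMeas w →
      ∫ x, w x * kernelAct K w x ∂π ≤ ∫ x, w x ^ 2 * r x ∂π)
    {u w : α → ℝ} (hu : BddMeas u) (hw : BddMeas w) :
    2 * ∫ x, u x * kernelAct K w x ∂π ≤ ∫ x, u x ^ 2 * r x ∂π + ∫ x, w x ^ 2 * r x ∂π := by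
  have hadd := hu.add hw
  have hsub := hu.sub hw
  have h1 := hform _ hadd
  have h2 := hform _ hsub.abs
  have hinv := hK.invariant
  have I : ∀ {f g : α → ℝ}, BddMeas f → BddMeas g →
      Integrable (fun z : α × α => f z.1 * g z.2) (π ⊗ₘ K) := fun hf hg =>
    integrable_mul_compProd hinv (hf.memLp 2 π) (hg.memLp 2 π)
  have hcomm := integral_mul_kernelAct_comm hK (hu.memLp 2 π) (hw.memLp 2 π)
  rw [integral_mul_kernelAct hinv (hadd.memLp 2 π) (hadd.memLp 2 π)] at h1
  rw [integral_mul_kernelAct hinv (hsub.abs.memLp 2 π) (hsub.abs.memLp 2 π)] at h2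
  rw [integral_mul_kernelAct hinv (hu.memLp 2 π) (hw.memLp 2 π),
    integral_mul_kernelAct hinv (hw.memLp 2 π) (hu.memLp 2 π)] at hcomm
  rw [integral_mul_kernelAct hinv (hu.memLp 2 π) (hw.memLp 2 π)]
  -- The usual polarisation subtracts the form at `u - w`; positivity of the pair law replaces this
  -- by adding the form at `|u - w|`, for which `hform` gives an upper bound.
  have h3 : 2 * (∫ z, u z.1 * w z.2 ∂(π ⊗ₘ K)) + 2 * ∫ z, w z.1 * u z.2 ∂(π ⊗ₘ K) ≤
      (∫ z, (u z.1 + w z.1) * (u z.2 + w z.2) ∂(π ⊗ₘ K)) +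
        ∫ z, |u z.1 - w z.1| * |u z.2 - w z.2| ∂(π ⊗ₘ K) := by
    rw [← integral_const_mul, ← integral_const_mul,
      ← integral_add ((I hu hw).const_mul 2) ((I hw hu).const_mul 2),
      ← integral_add (I hadd hadd) (I hsub.abs hsub.abs)]
    refine integral_mono (((I hu hw).const_mul 2).add ((I hw hu).const_mul 2))
      ((I hadd hadd).add (I hsub.abs hsub.abs)) fun z => ?_
    have := neg_abs_le ((u z.1 - w z.1) * (u z.2 - w z.2))
    rw [abs_mul] at this
    simp only
    linarith
  have h4 : ∫ x, (u x + w x) ^ 2 * r x ∂π + ∫ x, |u x - w x| ^ 2 * r x ∂π =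
      2 * ∫ x, u x ^ 2 * r x ∂π + 2 * ∫ x, w x ^ 2 * r x ∂π := by
    rw [← integral_const_mul, ← integral_const_mul,
      ← integral_add ((hadd.sq.mul hr).integrable π) ((hsub.abs.sq.mul hr).integrable π),
      ← integral_add (((hu.sq.mul hr).integrable π).const_mul 2)
        (((hw.sq.mul hr).integrable π).const_mul 2)]
    refine integral_congr_ae (Filter.Eventually.of_forall fun x => ?_)
    simp only [sq_abs]
    ring
  linarith

/-- If `⟨w, P w⟩ ≤ ∫ w² / V`, then `w ↦ V · P w` is a contraction in `L₂(π / V)`. -/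
lemma integral_sq_weighted_le (hK : K.IsReversible π) {V : α → ℝ} (hV : BddMeas V)
    (hVpos : ∀ x, 0 < V x) (hr : BddMeas fun x => (V x)⁻¹)
    (hform : ∀ w : α → ℝ, BddMeas w →
      ∫ x, w x * kernelAct K w x ∂π ≤ ∫ x, w x ^ 2 * (V x)⁻¹ ∂π)
    {w : α → ℝ} (hw : BddMeas w) :
    ∫ x, (V x * kernelAct K w x) ^ 2 * (V x)⁻¹ ∂π ≤ ∫ x, w x ^ 2 * (V x)⁻¹ ∂π := by
  -- With `u = V · P w` the left side is twice the weighted square norm of `u`, and one copy cancels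
  -- against the right side.
  have h := integral_mul_kernelAct_le_half hK hr hform (hV.mul (hw.kernelAct (K := K))) hw
  have e : ∫ x, (V x * kernelAct K w x) * kernelAct K w x ∂π =
      ∫ x, (V x * kernelAct K w x) ^ 2 * (V x)⁻¹ ∂π := by
    refine integral_congr_ae (Filter.Eventually.of_forall fun x => ?_)
    have := (hVpos x).ne'
    simp only
    field_simp
  rw [e] at h
  linarith

/-- The weighted Markov operator `w ↦ V · P w`. -/
noncomputable def weightedAct (K : Kernel α α) (V : α → ℝ) (w : α → ℝ) : α → ℝ :=
  fun x => V x * kernelAct K w x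

lemma BddMeas.iterate_weightedAct {V : α → ℝ} (hV : BddMeas V) {w : α → ℝ} (hw : BddMeas w)
    (n : ℕ) : BddMeas ((weightedAct K V)^[n] w) := by
  induction n generalizing w with
  | zero => exact hw
  | succ n ih => exact ih (hV.mul (hw.kernelAct (K := K)))

lemma integral_sq_iterate_weightedAct_le (hK : K.IsReversible π) {V : α → ℝ} (hV : BddMeas V)
    (hVpos : ∀ x, 0 < V x) (hr : BddMeas fun x => (V x)⁻¹)
    (hform : ∀ w : α → ℝ, BddMeas w →
      ∫ x, w x * kernelAct K w x ∂π ≤ ∫ x, w x ^ 2 * (V x)⁻¹ ∂π)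
    {w : α → ℝ} (hw : BddMeas w) (n : ℕ) :
    ∫ x, ((weightedAct K V)^[n] w x) ^ 2 * (V x)⁻¹ ∂π ≤ ∫ x, w x ^ 2 * (V x)⁻¹ ∂π := by
  induction n generalizing w with
  | zero => exact le_rfl
  | succ n ih =>
    exact (ih (hV.mul (hw.kernelAct (K := K)))).trans
      (integral_sq_weighted_le hK hV hVpos hr hform hw)

/-- Cauchy–Schwarz against `dν/dπ`: the initial law costs one factor, which becomes `log ‖dν/dπ‖₂`
in the final bound. -/
lemma integral_le_densityNorm {ν : Measure α} [IsProbabilityMeasure ν] (hν : HasL2Density ν π)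
    {F : α → ℝ} (hF : BddMeas F) {b : ℝ} (hb : 0 ≤ b) (hFb : ∫ x, F x ^ 2 ∂π ≤ b ^ 2) :
    ∫ x, F x ∂ν ≤ b * densityNorm ν π := by
  have h1 := integral_rnDeriv_smul (μ := ν) (ν := π) hν.1 (f := F)
  have hF2 := hF.memLp 2 π
  have h2 : inner ℝ (hF2.toLp F) (hν.2.toLp _) = ∫ x, F x ∂ν := by
    rw [← h1, L2.inner_def]
    refine integral_congr_ae ?_
    filter_upwards [hF2.coeFn_toLp, hν.2.coeFn_toLp] with x hx hx2
    simp [hx, hx2]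
  have h3 : ‖hF2.toLp F‖ ≤ b := by
    rw [← norm_toLp_sq hF2] at hFb
    exact (pow_le_pow_iff_left₀ (norm_nonneg _) hb two_ne_zero).1 hFb
  have h4 : ‖hν.2.toLp _‖ = densityNorm ν π := Lp.norm_toLp _ hν.2
  rw [← h2, ← h4]
  exact (real_inner_le_norm _ _).trans (mul_le_mul_of_nonneg_right h3 (norm_nonneg _))

lemma one_le_densityNorm {ν : Measure α} [IsProbabilityMeasure ν] (hν : HasL2Density ν π) :
    1 ≤ densityNorm ν π := by
  simpa using integral_le_densityNorm hν (BddMeas.const 1) zero_le_one (by simp)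

/-- The exponential moment of a path of the chain, by the contraction property. -/
lemma integral_iterate_weightedAct_le (hK : K.IsReversible π) {ν : Measure α}
    [IsProbabilityMeasure ν] (hν : HasL2Density ν π) {V : α → ℝ} (hV : BddMeas V)
    (hVpos : ∀ x, 0 < V x) (hr : BddMeas fun x => (V x)⁻¹) {b : ℝ} (hb : ∀ x, V x ≤ b)
    (hform : ∀ w : α → ℝ, BddMeas w →
      ∫ x, w x * kernelAct K w x ∂π ≤ ∫ x, w x ^ 2 * (V x)⁻¹ ∂π) (n : ℕ) :
    ∫ x, (weightedAct K V)^[n] V x ∂ν ≤ b * densityNorm ν π := by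
  have hne : Nonempty α := nonempty_of_isProbabilityMeasure ν
  have hb0 : 0 ≤ b := (hVpos hne.some).le.trans (hb _)
  have hF := hV.iterate_weightedAct hV (K := K) n
  refine integral_le_densityNorm hν hF hb0 ?_
  calc ∫ x, ((weightedAct K V)^[n] V x) ^ 2 ∂π
      ≤ ∫ x, b * (((weightedAct K V)^[n] V x) ^ 2 * (V x)⁻¹) ∂π := by
        refine integral_mono (hF.sq.integrable π) (((hF.sq.mul hr).integrable π).const_mul b)
          fun x => ?_
        have h1 : 1 ≤ b * (V x)⁻¹ := by
          rw [← div_eq_mul_inv, one_le_div (hVpos x)]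
          exact hb x
        have := mul_le_mul_of_nonneg_left h1 (sq_nonneg ((weightedAct K V)^[n] V x))
        simp only
        linarith
    _ = b * ∫ x, ((weightedAct K V)^[n] V x) ^ 2 * (V x)⁻¹ ∂π := integral_const_mul _ _
    _ ≤ b * ∫ x, V x ^ 2 * (V x)⁻¹ ∂π := by
        refine mul_le_mul_of_nonneg_left ?_ hb0
        exact integral_sq_iterate_weightedAct_le hK hV hVpos hr hform hV n
    _ ≤ b * ∫ _, b ∂π := by
        refine mul_le_mul_of_nonneg_left ?_ hb0
        refine integral_mono ((hV.sq.mul hr).integrable π) (integrable_const b) fun x => ?_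
        have := (hVpos x).ne'
        simp only
        field_simp
        exact hb x
    _ = b ^ 2 := by
        simp
        ring

end Contraction

/-! ### Exponential weights of an indicator function. -/

section Tilt

/-- The scalar inequality behind the exponential moment bound for a two-valued function. -/
lemma two_point_le_one {Λ t p S : ℝ} (hΛ : 0 ≤ Λ) (hΛ1 : Λ < 1) (ht : 0 ≤ t)
    (hta : t ≤ 1 - Λ) (hp : 0 ≤ p) (hp1 : p ≤ 1)
    (hS : 2 * (1 - Λ) * S = (1 + Λ) * t ^ 2) :
    Λ < (Real.exp (t * (1 - p) - S))⁻¹ ∧ Λ < (Real.exp (t * (0 - p) - S))⁻¹ ∧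
      (1 - Λ) * (p * ((Real.exp (t * (1 - p) - S))⁻¹ - Λ)⁻¹ +
        (1 - p) * ((Real.exp (t * (0 - p) - S))⁻¹ - Λ)⁻¹) ≤ 1 := by
  set a := 1 - Λ with ha
  have ha0 : 0 < a := by linarith
  have hS0 : 0 ≤ S := by
    have : 0 ≤ 2 * a * S := by rw [hS]; positivity
    exact nonneg_of_mul_nonneg_right this (by linarith)
  have hSt : t ^ 2 ≤ 2 * a * S := by rw [hS]; nlinarith [sq_nonneg t]
  -- `x₁` and `x₀` are the lower bounds for `1 / V - Λ` on and off the set that come from `exp (-z)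
  -- ≥ 1 - z`.
  set x₁ := a - t * (1 - p) + S with hx₁
  set x₀ := a + t * p + S with hx₀
  have htp : t * (1 - p) ≤ t := by nlinarith
  have htp' : 0 ≤ t * p := by positivity
  have h₁ : 0 < x₁ := by
    rcases ht.eq_or_lt with h | h
    · rw [hx₁, ← h]; linarith
    · have : 0 < 2 * a * S := lt_of_lt_of_le (by positivity) hSt
      have : 0 < S := pos_of_mul_pos_right this (by linarith)
      linarith
  have h₀ : 0 < x₀ := by linarith
  have e₁ : x₁ ≤ (Real.exp (t * (1 - p) - S))⁻¹ - Λ := by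
    rw [← Real.exp_neg]
    linarith [Real.add_one_le_exp (-(t * (1 - p) - S))]
  have e₀ : x₀ ≤ (Real.exp (t * (0 - p) - S))⁻¹ - Λ := by
    rw [← Real.exp_neg]
    linarith [Real.add_one_le_exp (-(t * (0 - p) - S))]
  refine ⟨by linarith, by linarith, ?_⟩
  have key : a * (p * x₁⁻¹ + (1 - p) * x₀⁻¹) ≤ 1 := by
    -- Clearing denominators, `x₁ x₀ - a (p x₀ + (1 - p) x₁) = S (a + t (2p - 1) + S) - t² p (1 -
    -- p)`. After inserting `t² ≤ 2 a S` what remains is the sum of nonnegative terms in `h3`.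
    have hu : 0 ≤ a + t * (2 * p - 1) + S := by nlinarith
    have h1 : 0 ≤ a * (S * (a + t * (2 * p - 1) + S) - t ^ 2 * (p * (1 - p))) := by
      have h2 : t ^ 2 * (a + t * (2 * p - 1)) ≤ 2 * a * S * (a + t * (2 * p - 1) + S) :=
        mul_le_mul hSt (by linarith) (by nlinarith) (by positivity)
      have h3 : 0 ≤ t ^ 2 *
          ((a - t) * (1 + (2 * p - 1) ^ 2) + t * (1 + (2 * p - 1)) ^ 2) := by
        have : 0 ≤ a - t := by linarith
        positivity
      nlinarith
    have h4 := nonneg_of_mul_nonneg_right h1 ha0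
    have h5 : a * (p * x₁⁻¹ + (1 - p) * x₀⁻¹) = a * (p * x₀ + (1 - p) * x₁) / (x₁ * x₀) := by
      field_simp
    rw [h5, div_le_one (by positivity), hx₁, hx₀]
    nlinarith
  refine le_trans ?_ key
  have hp1' : 0 ≤ 1 - p := by linarith
  gcongr

variable {α : Type*} [MeasurableSpace α]

open Classical in
/-- The weight `exp (t (1_A - π A) - S)`. -/
noncomputable def tilt (π : Measure α) (A : Set α) (t S : ℝ) : α → ℝ := fun x =>
  if x ∈ A then Real.exp (t * (1 - π.real A) - S) else Real.exp (t * (0 - π.real A) - S)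

lemma tilt_eq (π : Measure α) (A : Set α) (t S : ℝ) (x : α) :
    tilt π A t S x = Real.exp (t * (A.indicator (fun _ => 1) x - π.real A) - S) := by
  by_cases hx : x ∈ A <;> simp [tilt, hx]

lemma tilt_pos (π : Measure α) (A : Set α) (t S : ℝ) (x : α) : 0 < tilt π A t S x := by
  rw [tilt_eq]
  positivity

lemma bddMeas_tilt (π : Measure α) {A : Set α} (hA : MeasurableSet A) (t S : ℝ) :
    BddMeas (tilt π A t S) := by
  classical
  exact BddMeas.ite hA _ _

lemma bddMeas_tilt_inv (π : Measure α) {A : Set α} (hA : MeasurableSet A) (t S : ℝ) :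
    BddMeas fun x => (tilt π A t S x)⁻¹ := by
  classical
  simp only [tilt, apply_ite Inv.inv]
  exact BddMeas.ite hA _ _

lemma tilt_le {π : Measure α} [IsProbabilityMeasure π] (A : Set α) {t S : ℝ} (ht : 0 ≤ t)
    (ht1 : t ≤ 1) (hS : 0 ≤ S) (x : α) : tilt π A t S x ≤ Real.exp 1 := by
  rw [tilt_eq]
  refine Real.exp_le_exp.2 ?_
  have h0 : 0 ≤ π.real A := measureReal_nonneg
  have h1 : A.indicator (fun _ => (1 : ℝ)) x ≤ 1 := Set.indicator_le_self' (by simp) x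
  nlinarith

variable {K : Kernel α α} [IsMarkovKernel K] {π : Measure α} [IsProbabilityMeasure π]

lemma integral_mul_kernelAct_le_tilt (hK : K.IsReversible π) {Λ : ℝ}
    (hspec : spectralSup K π hK ≤ Λ) (hΛ : 0 ≤ Λ) (hΛ1 : Λ < 1) {A : Set α}
    (hA : MeasurableSet A) {t S : ℝ} (ht : 0 ≤ t) (hta : t ≤ 1 - Λ)
    (hS : 2 * (1 - Λ) * S = (1 + Λ) * t ^ 2) {w : α → ℝ} (hw : BddMeas w) :
    ∫ x, w x * kernelAct K w x ∂π ≤ ∫ x, w x ^ 2 * (tilt π A t S x)⁻¹ ∂π := by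
  classical
  obtain ⟨h1, h0, h2⟩ := two_point_le_one hΛ hΛ1 ht hta (measureReal_nonneg (μ := π) (s := A))
    measureReal_le_one hS
  have e : (fun x => ((tilt π A t S x)⁻¹ - Λ)⁻¹) = fun x => if x ∈ A then
      ((Real.exp (t * (1 - π.real A) - S))⁻¹ - Λ)⁻¹ else
      ((Real.exp (t * (0 - π.real A) - S))⁻¹ - Λ)⁻¹ := by
    funext x
    by_cases hx : x ∈ A <;> simp [tilt, hx]
  refine integral_mul_kernelAct_le_weighted hK hspec hΛ1 (bddMeas_tilt_inv π hA t S) ?_ ?_ ?_ hw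
  · intro x
    by_cases hx : x ∈ A
    · simpa [tilt, hx] using h1
    · simpa [tilt, hx] using h0
  · rw [e]
    exact BddMeas.ite hA _ _
  · rw [e, integral_ite_mem hA]
    exact h2

end Tilt

/-! ### Path expectations as iterates of the weighted operator, and the Hoeffding bound. -/

section Path

variable {α : Type*} {s : ℕ} {φ : α → Cube s → α} {ψ : Cube s → α}

lemma drivenState_snoc {n : ℕ} (u : Fin n → Cube s) (a : Cube s) (i : ℕ) (hi : i < n)
    (hi' : i < n + 1) :
    drivenState φ ψ (Fin.snoc (α := fun _ => Cube s) u a) i hi' = drivenState φ ψ u i hi := by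
  induction i with
  | zero =>
    simp only [drivenState]
    exact congrArg ψ (Fin.snoc_castSucc (α := fun _ => Cube s) a u ⟨0, hi⟩)
  | succ i ih =>
    simp only [drivenState]
    rw [ih (Nat.lt_of_succ_lt hi)]
    exact congrArg _ (Fin.snoc_castSucc (α := fun _ => Cube s) a u ⟨i + 1, hi⟩)

lemma drivenState_snoc_last {n : ℕ} (u : Fin (n + 1) → Cube s) (a : Cube s) :
    drivenState φ ψ (Fin.snoc (α := fun _ => Cube s) u a) (n + 1) (Nat.lt_succ_self _) =
      φ (drivenState φ ψ u n (Nat.lt_succ_self _)) a := by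
  simp only [drivenState]
  rw [drivenState_snoc u a n (Nat.lt_succ_self _)]
  exact congrArg _ (Fin.snoc_last (α := fun _ => Cube s) a u)

variable [MeasurableSpace α]

lemma measurable_drivenState (hφ : Measurable (Function.uncurry φ)) (hψ : Measurable ψ) {n : ℕ}
    (i : ℕ) (hi : i < n) : Measurable fun u : Fin n → Cube s => drivenState φ ψ u i hi := by
  induction i with
  | zero => exact hψ.comp (measurable_pi_apply _)
  | succ i ih => exact hφ.comp ((ih (Nat.lt_of_succ_lt hi)).prodMk (measurable_pi_apply _))

lemma lintegral_snoc {n : ℕ} {f : (Fin (n + 1) → Cube s) → ℝ≥0∞} (hf : Measurable f) :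
    ∫⁻ u, f u = ∫⁻ u : Fin n → Cube s, ∫⁻ a, f (Fin.snoc (α := fun _ => Cube s) u a) := by
  have h := volume_preserving_piFinSuccAbove (fun _ : Fin (n + 1) => Cube s) (Fin.last n)
  rw [← h.symm.lintegral_comp hf, Measure.volume_eq_prod, lintegral_prod_symm']
  · simp [MeasurableEquiv.piFinSuccAbove, Fin.insertNthEquiv, Fin.insertNth_last']
  · exact hf.comp (MeasurableEquiv.measurable _)

/-- The weighted action of a kernel on `[0,∞]`-valued functions. -/
noncomputable def lweightedAct (K : Kernel α α) (W g : α → ℝ≥0∞) : α → ℝ≥0∞ :=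
  fun x => W x * ∫⁻ y, g y ∂(K x)

lemma IsUpdateFunction.lintegral_eq {K : Kernel α α} (hφ : IsUpdateFunction φ K) (x : α)
    {g : α → ℝ≥0∞} (hg : Measurable g) : ∫⁻ a, g (φ x a) = ∫⁻ y, g y ∂(K x) := by
  have hm : Measurable (φ x) := hφ.1.comp (measurable_const.prodMk measurable_id)
  have : K x = Measure.map (φ x) volume := by
    ext A hA
    rw [hφ.2 x A hA, Measure.map_apply hm hA]
    rfl
  rw [this, lintegral_map hg hm]

lemma IsGeneratorFunction.lintegral_eq {ν : Measure α} (hψ : IsGeneratorFunction ψ ν)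
    {g : α → ℝ≥0∞} (hg : Measurable g) : ∫⁻ a, g (ψ a) = ∫⁻ y, g y ∂ν := by
  have : ν = Measure.map ψ volume := by
    ext A hA
    rw [hψ.2 A hA, Measure.map_apply hψ.1 hA]
    rfl
  rw [this, lintegral_map hg hψ.1]

/-- Integrating out the last driver replaces the terminal function `g` by `W · P g` and shortens the
path by one step. Keeping `g` separate from `W` is what makes the induction close. -/
lemma lintegral_path {K : Kernel α α} [IsMarkovKernel K] {ν : Measure α}
    (hφ : IsUpdateFunction φ K) (hψ : IsGeneratorFunction ψ ν) {W : α → ℝ≥0∞}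
    (hW : Measurable W) (m : ℕ) {g : α → ℝ≥0∞} (hg : Measurable g) :
    ∫⁻ u : Fin (m + 1) → Cube s,
      (∏ i : Fin m, W (drivenState φ ψ u i (i.isLt.trans (Nat.lt_succ_self m)))) *
        g (drivenState φ ψ u m (Nat.lt_succ_self m)) =
      ∫⁻ x, (lweightedAct K W)^[m] g x ∂ν := by
  have hmeas : ∀ (m : ℕ) {g : α → ℝ≥0∞}, Measurable g →
      Measurable fun u : Fin (m + 1) → Cube s =>
        (∏ i : Fin m, W (drivenState φ ψ u i (i.isLt.trans (Nat.lt_succ_self m)))) *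
          g (drivenState φ ψ u m (Nat.lt_succ_self m)) := fun m g hg =>
    (Finset.measurable_prod _ fun i _ =>
      hW.comp (measurable_drivenState hφ.1 hψ.1 _ _)).mul
      (hg.comp (measurable_drivenState hφ.1 hψ.1 _ _))
  induction m generalizing g with
  | zero =>
    rw [lintegral_snoc (hmeas 0 hg)]
    simp only [Finset.univ_eq_empty, Finset.prod_empty, one_mul, Function.iterate_zero, id,
      drivenState]
    have e : ∀ (u : Fin 0 → Cube s) (a : Cube s),
        Fin.snoc (α := fun _ => Cube s) u a ⟨0, Nat.lt_succ_self 0⟩ = a := fun u a =>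
      Fin.snoc_last (α := fun _ => Cube s) a u
    simp only [e, hψ.lintegral_eq hg]
    simp
  | succ m ih =>
    rw [lintegral_snoc (hmeas (m + 1) hg)]
    have hTg : Measurable (lweightedAct K W g) := hW.mul hg.lintegral_kernel
    rw [Function.iterate_succ_apply, ← ih hTg]
    refine lintegral_congr fun u => ?_
    simp only [drivenState_snoc_last]
    have e : ∀ (a : Cube s) (i : Fin (m + 1)),
        drivenState φ ψ (Fin.snoc (α := fun _ => Cube s) u a) i
          (i.isLt.trans (Nat.lt_succ_self _)) = drivenState φ ψ u i i.isLt := fun a i =>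
      drivenState_snoc u a i i.isLt _
    simp only [e]
    have hφu : Measurable fun a => g (φ (drivenState φ ψ u m (Nat.lt_succ_self m)) a) :=
      hg.comp (hφ.1.comp (measurable_const.prodMk measurable_id))
    rw [lintegral_const_mul _ hφu,
      hφ.lintegral_eq _ hg, Fin.prod_univ_castSucc]
    simp only [lweightedAct, Fin.val_castSucc, Fin.val_last, mul_assoc]

lemma ofReal_iterate_weightedAct {K : Kernel α α} [IsMarkovKernel K] {V : α → ℝ}
    (hV : BddMeas V) (hV0 : ∀ x, 0 ≤ V x) (m : ℕ) {g : α → ℝ} (hg : BddMeas g)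
    (hg0 : ∀ x, 0 ≤ g x) :
    (∀ x, 0 ≤ (weightedAct K V)^[m] g x) ∧
    (lweightedAct K fun x => ENNReal.ofReal (V x))^[m] (fun x => ENNReal.ofReal (g x)) =
      fun x => ENNReal.ofReal ((weightedAct K V)^[m] g x) := by
  induction m generalizing g with
  | zero => exact ⟨hg0, rfl⟩
  | succ m ih =>
    have h1 : ∀ x, 0 ≤ kernelAct K g x := fun x => integral_nonneg hg0
    have h2 : lweightedAct K (fun x => ENNReal.ofReal (V x)) (fun x => ENNReal.ofReal (g x)) =
        fun x => ENNReal.ofReal (weightedAct K V g x) := by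
      funext x
      rw [lweightedAct, weightedAct, ENNReal.ofReal_mul (hV0 x), kernelAct,
        ofReal_integral_eq_lintegral_ofReal (hg.integrable _)
          (Filter.Eventually.of_forall hg0)]
    rw [Function.iterate_succ_apply, Function.iterate_succ_apply, h2]
    exact ih (g := weightedAct K V g) (hV.mul hg.kernelAct) fun x => mul_nonneg (hV0 x) (h1 x)

lemma lintegral_prod_path {K : Kernel α α} [IsMarkovKernel K] {ν : Measure α}
    [IsProbabilityMeasure ν] (hφ : IsUpdateFunction φ K) (hψ : IsGeneratorFunction ψ ν)
    {V : α → ℝ} (hV : BddMeas V) (hV0 : ∀ x, 0 ≤ V x) (m : ℕ) :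
    ∫⁻ u : Fin (m + 1) → Cube s, ENNReal.ofReal (∏ i, V (drivenPoints φ ψ u i)) =
      ENNReal.ofReal (∫ x, (weightedAct K V)^[m] V x ∂ν) := by
  have hW : Measurable fun x => ENNReal.ofReal (V x) := hV.1.ennreal_ofReal
  obtain ⟨h0, h1⟩ := ofReal_iterate_weightedAct (K := K) hV hV0 m hV hV0
  rw [ofReal_integral_eq_lintegral_ofReal ((hV.iterate_weightedAct hV m).integrable ν)
    (Filter.Eventually.of_forall h0)]
  have h2 := lintegral_path hφ hψ hW m hW
  rw [h1] at h2
  rw [← h2]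
  refine lintegral_congr fun u => ?_
  rw [ENNReal.ofReal_prod_of_nonneg fun i _ => hV0 _, Fin.prod_univ_castSucc]
  rfl

/-- A Hoeffding type inequality for the number of visits to a set. -/
theorem measure_visits_ge_le {K : Kernel α α} [IsMarkovKernel K] {π ν : Measure α}
    [IsProbabilityMeasure π] [IsProbabilityMeasure ν] (hK : K.IsReversible π)
    (hν : HasL2Density ν π) (hφ : IsUpdateFunction φ K) (hψ : IsGeneratorFunction ψ ν) {Λ : ℝ}
    (hspec : spectralSup K π hK ≤ Λ) (hΛ : 0 ≤ Λ) (hΛ1 : Λ < 1) {A : Set α}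
    (hA : MeasurableSet A) {n : ℕ} (hn : 0 < n) {c : ℝ} (hc : 0 ≤ c) (hc1 : c ≤ 1) :
    volume {u : Fin n → Cube s | n * c ≤
        ∑ i, (A.indicator (fun _ => (1 : ℝ)) (drivenPoints φ ψ u i) - π.real A)} ≤
      ENNReal.ofReal (Real.exp 1 * densityNorm ν π *
        Real.exp (-(n * c ^ 2 * ((1 - Λ) / (2 * (1 + Λ)))))) := by
  obtain ⟨m, rfl⟩ : ∃ m, n = m + 1 := ⟨n - 1, by omega⟩
  have hb : 0 < 1 + Λ := by linarith
  have ha : 0 < 1 - Λ := by linarith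
  -- The maximiser of `t c - S` when `S = (1 + Λ) t² / (2 (1 - Λ))`; at this point `t c = 2 S`, so
  -- the optimal exponent is `S` itself. The bound `c ≤ 1` ensures `t ≤ 1 - Λ`.
  set t : ℝ := c * (1 - Λ) / (1 + Λ) with ht
  set S : ℝ := c ^ 2 * ((1 - Λ) / (2 * (1 + Λ))) with hS
  have htc : t * c = 2 * S := by
    rw [ht, hS]
    field_simp
  have ht0 : 0 ≤ t := by positivity
  have hS0 : 0 ≤ S := by positivity
  have hta : t ≤ 1 - Λ := by
    rw [ht, div_le_iff₀ hb]
    nlinarith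
  have hSt : 2 * (1 - Λ) * S = (1 + Λ) * t ^ 2 := by
    rw [ht, hS]
    field_simp
  set V := tilt π A t S with hV
  have hVm := bddMeas_tilt π hA t S
  have h1 := lintegral_prod_path hφ hψ hVm (fun x => (tilt_pos π A t S x).le) m
  have h2 := integral_iterate_weightedAct_le hK hν hVm (tilt_pos π A t S)
    (bddMeas_tilt_inv π hA t S) (tilt_le A ht0 (by linarith) hS0)
    (fun w hw => integral_mul_kernelAct_le_tilt hK hspec hΛ hΛ1 hA ht0 hta hSt hw) m
  have hmeas : Measurable fun u : Fin (m + 1) → Cube s =>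
      ENNReal.ofReal (∏ i, V (drivenPoints φ ψ u i)) :=
    (Finset.measurable_prod _ fun i _ =>
      hVm.1.comp (measurable_drivenState hφ.1 hψ.1 _ _)).ennreal_ofReal
  -- Markov's inequality at level `exp (n S)`: on the event, the exponent of the product is at least
  -- `n t c - n S = n S`.
  have h3 := mul_meas_ge_le_lintegral (μ := volume) hmeas (ENNReal.ofReal (Real.exp ((m + 1 : ℕ) * S)))
  rw [h1] at h3
  have hpos : 0 < Real.exp ((m + 1 : ℕ) * S) := Real.exp_pos _
  have hsub : {u : Fin (m + 1) → Cube s | (m + 1 : ℕ) * c ≤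
        ∑ i, (A.indicator (fun _ => (1 : ℝ)) (drivenPoints φ ψ u i) - π.real A)} ⊆
      {u | ENNReal.ofReal (Real.exp ((m + 1 : ℕ) * S)) ≤
        ENNReal.ofReal (∏ i, V (drivenPoints φ ψ u i))} := by
    intro u hu
    simp only [Set.mem_ofPred_eq] at hu ⊢
    refine ENNReal.ofReal_le_ofReal ?_
    simp only [hV, tilt_eq]
    rw [← Real.exp_sum]
    refine Real.exp_le_exp.2 ?_
    rw [Finset.sum_sub_distrib, ← Finset.mul_sum]
    simp only [Finset.sum_const, Finset.card_univ, Fintype.card_fin, nsmul_eq_mul]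
    have := mul_le_mul_of_nonneg_left hu ht0
    have e : t * ((m + 1 : ℕ) * c) = (m + 1 : ℕ) * (2 * S) := by rw [← htc]; ring
    linarith
  refine (measure_mono hsub).trans ?_
  have e : Real.exp 1 * densityNorm ν π *
        Real.exp (-((m + 1 : ℕ) * c ^ 2 * ((1 - Λ) / (2 * (1 + Λ))))) =
      Real.exp 1 * densityNorm ν π / Real.exp ((m + 1 : ℕ) * S) := by
    rw [mul_assoc ((m + 1 : ℕ) : ℝ), ← hS, Real.exp_neg, ← div_eq_mul_inv]
  rw [e, ENNReal.ofReal_div_of_pos hpos,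
    ENNReal.le_div_iff_mul_le (Or.inl (by simpa using hpos)) (Or.inl ENNReal.ofReal_ne_top),
    mul_comm]
  exact h3.trans (ENNReal.ofReal_le_ofReal h2)

end Path

/-! ### Bracketing of half-lines and boxes by quantiles. -/

section Brackets

lemma exists_quantile (μ : Measure ℝ) [IsProbabilityMeasure μ] {p : ℝ} (hp : 0 < p)
    (hp1 : p < 1) : ∃ q, μ.real (Set.Iio q) ≤ p ∧ p ≤ μ.real (Set.Iic q) := by
  set s : Set ℝ := {x | p ≤ cdf μ x} with hs
  have hne : s.Nonempty := by
    obtain ⟨x, hx⟩ := ((tendsto_order.1 (tendsto_cdf_atTop μ)).1 p hp1).exists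
    exact ⟨x, hx.le⟩
  have hbd : BddBelow s := by
    obtain ⟨b, hb⟩ := ((tendsto_order.1 (tendsto_cdf_atBot μ)).2 p hp).exists
    refine ⟨b, fun x hx => ?_⟩
    by_contra! h
    exact absurd (monotone_cdf μ h.le) (not_le.2 (hb.trans_le hx))
  refine ⟨sInf s, ?_, ?_⟩
  · have h1 : μ (Set.Iio (sInf s)) ≤ ENNReal.ofReal p := by
      conv_lhs => rw [← measure_cdf μ]
      rw [StieltjesFunction.measure_Iio _ (tendsto_cdf_atBot μ), sub_zero]
      refine ENNReal.ofReal_le_ofReal ?_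
      refine le_of_tendsto ((monotone_cdf μ).tendsto_leftLim (sInf s)) ?_
      filter_upwards [self_mem_nhdsWithin] with x hx
      by_contra! h
      exact absurd (csInf_le hbd h.le) (not_le.2 hx)
    exact ENNReal.toReal_le_of_le_ofReal hp.le h1
  · rw [← cdf_eq_real]
    have h1 := ((cdf μ).right_continuous (sInf s)).mono_left
      (nhdsWithin_mono _ Set.Ioi_subset_Ici_self)
    refine ge_of_tendsto h1 ?_
    filter_upwards [self_mem_nhdsWithin] with x hx
    obtain ⟨y, hy, hyx⟩ := exists_lt_of_csInf_lt hne hx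
    exact le_trans hy (monotone_cdf μ hyx.le)

/-- Lower sets of a line are nested. The case `U ⊆ L` does occur: an atom can make consecutive
quantiles coincide. -/
lemma measureReal_diff_le_of_isLowerSet (μ : Measure ℝ) [IsProbabilityMeasure μ] {L U : Set ℝ}
    (hL : IsLowerSet L) (hU : IsLowerSet U) (hLm : MeasurableSet L) {a b : ℝ}
    (hab : a ≤ b) (ha : a ≤ μ.real L) (hb : μ.real U ≤ b) : μ.real (U \ L) ≤ b - a := by
  rcases hL.total hU with h | h
  · rw [measureReal_sdiff h hLm]
    linarith
  · rw [Set.sdiff_eq_empty.2 h]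
    simpa using hab

/-- The half-lines have a bracketing by `k` pairs of sets with gaps of measure at most `1 / k`. -/
lemma exists_brackets_Iio (μ : Measure ℝ) [IsProbabilityMeasure μ] {k : ℕ} (hk : 0 < k) :
    ∃ L U : Fin k → Set ℝ, (∀ i, MeasurableSet (L i)) ∧ (∀ i, MeasurableSet (U i)) ∧
      (∀ i, μ.real (U i \ L i) ≤ 1 / k) ∧
      ∀ x, ∃ i, L i ⊆ Set.Iio x ∧ Set.Iio x ⊆ U i := by
  have hk' : (0 : ℝ) < k := Nat.cast_pos.2 hk
  have hq : ∀ i : ℕ, ∃ q : ℝ, 0 < i → i < k →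
      μ.real (Set.Iio q) ≤ i / k ∧ (i / k : ℝ) ≤ μ.real (Set.Iic q) := by
    intro i
    by_cases h : 0 < i ∧ i < k
    · obtain ⟨q, hq⟩ := exists_quantile μ (p := i / k) (div_pos (Nat.cast_pos.2 h.1) hk')
        ((div_lt_one hk').2 (Nat.cast_lt.2 h.2))
      exact ⟨q, fun _ _ => hq⟩
    · exact ⟨0, fun h1 h2 => absurd ⟨h1, h2⟩ h⟩
  choose q hq using hq
  -- Closed inner and open outer half-lines leave the atoms at the quantiles out of the gap, so no
  -- continuity of `μ` is needed.
  refine ⟨fun i => if (i : ℕ) = 0 then ∅ else Set.Iic (q i),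
    fun i => if (i : ℕ) + 1 = k then Set.univ else Set.Iio (q (i + 1)), ?_, ?_, ?_, ?_⟩
  · intro i
    dsimp only
    split_ifs
    · exact MeasurableSet.empty
    · exact measurableSet_Iic
  · intro i
    dsimp only
    split_ifs
    · exact MeasurableSet.univ
    · exact measurableSet_Iio
  · intro i
    have e : (1 / k : ℝ) = ((i : ℕ) + 1 : ℕ) / k - (i : ℕ) / k := by
      push_cast
      ring
    dsimp only
    rw [e]
    refine measureReal_diff_le_of_isLowerSet μ ?_ ?_ ?_ ?_ ?_ ?_
    · split_ifs
      · exact isLowerSet_empty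
      · exact isLowerSet_Iic _
    · split_ifs
      · exact isLowerSet_univ
      · exact isLowerSet_Iio _
    · split_ifs
      · exact MeasurableSet.empty
      · exact measurableSet_Iic
    · gcongr
      omega
    · split_ifs with h
      · simp [h]
      · exact (hq i (Nat.pos_of_ne_zero h) i.isLt).2
    · split_ifs with h
      · rw [h, div_self hk'.ne']
        exact measureReal_le_one
      · exact (hq _ (Nat.succ_pos _) (by have := i.isLt; omega)).1
  · intro x
    classical
    set P : ℕ → Prop := fun i => i = 0 ∨ q i < x with hP
    -- The last index with `q i < x`, where index `0` counts as true; maximality gives `x ≤ q (i +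
    -- 1)`, unless `i + 1 = k` and the upper bracket is everything.
    set i := Nat.findGreatest P (k - 1) with hi
    have hPi : P i := Nat.findGreatest_spec (m := 0) (Nat.zero_le _) (Or.inl rfl)
    have hik : i ≤ k - 1 := Nat.findGreatest_le _
    refine ⟨⟨i, by omega⟩, ?_, ?_⟩
    · dsimp only
      split_ifs with h
      · exact Set.empty_subset _
      · exact Set.Iic_subset_Iio.2 (hPi.resolve_left h)
    · dsimp only
      split_ifs with h
      · exact Set.subset_univ _
      · have : ¬ P (i + 1) :=
          Nat.findGreatest_is_greatest (hi ▸ Nat.lt_succ_self i) (by omega)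
        simp only [hP, not_or, not_lt] at this
        exact Set.Iio_subset_Iio this.2

/-- The anchored boxes have a bracketing by `k ^ d` pairs of sets with gaps of measure at most
`d / k`. -/
lemma exists_brackets_anchoredBoxes {d : ℕ} (G : Set (Fin d → ℝ)) (π : Measure G)
    [IsProbabilityMeasure π] {k : ℕ} (hk : 0 < k) :
    ∃ L U : (Fin d → Fin k) → Set G, (∀ i, MeasurableSet (L i)) ∧ (∀ i, MeasurableSet (U i)) ∧
      (∀ i, π.real (U i \ L i) ≤ d / k) ∧
      ∀ A ∈ anchoredBoxes G, ∃ i, L i ⊆ A ∧ A ⊆ U i := by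
  have hc : ∀ j : Fin d, Measurable fun y : G => (y : Fin d → ℝ) j := fun j =>
    (measurable_pi_apply j).comp measurable_subtype_coe
  have hprob : ∀ j, IsProbabilityMeasure (π.map fun y : G => (y : Fin d → ℝ) j) := fun j =>
    Measure.isProbabilityMeasure_map (hc j).aemeasurable
  choose L U hL hU hLU hx using fun j =>
    exists_brackets_Iio (π.map fun y : G => (y : Fin d → ℝ) j) hk
  refine ⟨fun i => {y | ∀ j, (y : Fin d → ℝ) j ∈ L j (i j)},
    fun i => {y | ∀ j, (y : Fin d → ℝ) j ∈ U j (i j)}, ?_, ?_, ?_, ?_⟩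
  · intro i
    have : {y : G | ∀ j, (y : Fin d → ℝ) j ∈ L j (i j)} =
        ⋂ j, (fun y : G => (y : Fin d → ℝ) j) ⁻¹' L j (i j) := by
      ext y
      simp
    dsimp only
    rw [this]
    exact MeasurableSet.iInter fun j => hc j (hL j (i j))
  · intro i
    have : {y : G | ∀ j, (y : Fin d → ℝ) j ∈ U j (i j)} =
        ⋂ j, (fun y : G => (y : Fin d → ℝ) j) ⁻¹' U j (i j) := by
      ext y
      simp
    dsimp only
    rw [this]
    exact MeasurableSet.iInter fun j => hc j (hU j (i j))
  · intro i
    -- A point of the gap leaves the inner box in some coordinate, so `d` slabs of measure at most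
    -- `1 / k` cover it.
    have hsub : {y : G | ∀ j, (y : Fin d → ℝ) j ∈ U j (i j)} \
        {y : G | ∀ j, (y : Fin d → ℝ) j ∈ L j (i j)} ⊆
        ⋃ j, (fun y : G => (y : Fin d → ℝ) j) ⁻¹' (U j (i j) \ L j (i j)) := by
      rintro y ⟨h1, h2⟩
      simp only [Set.mem_ofPred_eq, not_forall] at h1 h2
      obtain ⟨j, hj⟩ := h2
      exact Set.mem_iUnion.2 ⟨j, h1 j, hj⟩
    calc π.real _ ≤ π.real (⋃ j, (fun y : G => (y : Fin d → ℝ) j) ⁻¹' (U j (i j) \ L j (i j))) :=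
          measureReal_mono hsub
      _ ≤ ∑ j, π.real ((fun y : G => (y : Fin d → ℝ) j) ⁻¹' (U j (i j) \ L j (i j))) :=
          measureReal_iUnion_fintype_le _
      _ ≤ ∑ _j : Fin d, (1 / k : ℝ) := by
          refine Finset.sum_le_sum fun j _ => ?_
          have := hLU j (i j)
          rwa [map_measureReal_apply (hc j) ((hU j (i j)).diff (hL j (i j)))] at this
      _ = d / k := by simp [div_eq_mul_inv]
  · rintro A ⟨x, rfl⟩
    choose i hi1 hi2 using fun j => hx j (x j)
    exact ⟨i, fun y hy j => hi1 j (hy j), fun y hy j => hi2 j (hy j)⟩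

end Brackets

/-! ### Reduction of the discrepancy to brackets, and the union bound. -/

section Discrepancy

lemma indicator_one_mem_Icc {α : Type*} (A : Set α) (y : α) :
    A.indicator (fun _ => (1 : ℝ)) y ∈ Set.Icc (0 : ℝ) 1 := by
  by_cases h : y ∈ A <;> simp [h]

variable {α : Type*} [MeasurableSpace α]

lemma starDiscrepancy_nonneg (𝒜 : Set (Set α)) (π : Measure α) {n : ℕ} (x : Fin n → α) :
    0 ≤ starDiscrepancy 𝒜 π x := Real.iSup_nonneg fun _ => abs_nonneg _

lemma starDiscrepancy_le_one (𝒜 : Set (Set α)) (π : Measure α) [IsProbabilityMeasure π] {n : ℕ}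
    (x : Fin n → α) : starDiscrepancy 𝒜 π x ≤ 1 := by
  refine Real.iSup_le (fun A => ?_) zero_le_one
  have h0 : 0 ≤ ∑ i, (A : Set α).indicator (fun _ => (1 : ℝ)) (x i) :=
    Finset.sum_nonneg fun i _ => (indicator_one_mem_Icc _ _).1
  have h1 : ∑ i, (A : Set α).indicator (fun _ => (1 : ℝ)) (x i) ≤ n := by
    refine (Finset.sum_le_sum fun i _ => (indicator_one_mem_Icc _ (x i)).2).trans ?_
    simp
  have h2 : 0 ≤ 1 / (n : ℝ) * ∑ i, (A : Set α).indicator (fun _ => (1 : ℝ)) (x i) := by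
    positivity
  have h3 : 1 / (n : ℝ) * ∑ i, (A : Set α).indicator (fun _ => (1 : ℝ)) (x i) ≤ 1 := by
    rw [one_div_mul_eq_div]
    exact div_le_one_of_le₀ h1 (Nat.cast_nonneg n)
  have h4 : π.real (A : Set α) ≤ 1 := measureReal_le_one
  have h5 : 0 ≤ π.real (A : Set α) := measureReal_nonneg
  rw [abs_le]
  constructor <;> linarith

/-- Upper deviations of the members of a bracketing and of their complements control the
discrepancy. -/
lemma abs_sub_le_of_bracket (π : Measure α) [IsProbabilityMeasure π] {n : ℕ} (hn : 0 < n)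
    (x : Fin n → α) {L A U : Set α} (hL : MeasurableSet L) (hLA : L ⊆ A) (hAU : A ⊆ U)
    {c δ : ℝ} (hδ : π.real (U \ L) ≤ δ)
    (hUc : ∑ i, (U.indicator (fun _ => (1 : ℝ)) (x i) - π.real U) < n * c)
    (hLc : ∑ i, (Lᶜ.indicator (fun _ => (1 : ℝ)) (x i) - π.real Lᶜ) < n * c) :
    |1 / (n : ℝ) * ∑ i, A.indicator (fun _ => (1 : ℝ)) (x i) - π.real A| ≤ c + δ := by
  have hn' : (0 : ℝ) < n := Nat.cast_pos.2 hn
  rw [measureReal_sdiff (hLA.trans hAU) hL] at hδ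
  have hmL : π.real L ≤ π.real A := measureReal_mono hLA
  have hmU : π.real A ≤ π.real U := measureReal_mono hAU
  set SA := ∑ i, A.indicator (fun _ => (1 : ℝ)) (x i) with hSA
  have hU1 : SA ≤ ∑ i, U.indicator (fun _ => (1 : ℝ)) (x i) :=
    Finset.sum_le_sum fun i _ =>
      Set.indicator_le_indicator_of_subset hAU (fun _ => zero_le_one) _
  -- Too few visits to `A` mean too many to `Lᶜ`, so a one-sided deviation bound suffices.
  have hL1 : ∑ i, Lᶜ.indicator (fun _ => (1 : ℝ)) (x i) ≥ n - SA := by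
    have : (n : ℝ) - SA = ∑ i : Fin n, (1 - A.indicator (fun _ => (1 : ℝ)) (x i)) := by
      simp [hSA]
    rw [this]
    refine Finset.sum_le_sum fun i _ => ?_
    by_cases h : x i ∈ L
    · simp [h, hLA h]
    · have := (indicator_one_mem_Icc A (x i)).1
      simp only [Set.indicator_of_mem (show x i ∈ Lᶜ from h)]
      linarith
  rw [probReal_compl_eq_one_sub hL] at hLc
  simp only [Finset.sum_sub_distrib, Finset.sum_const, Finset.card_univ, Fintype.card_fin,
    nsmul_eq_mul] at hUc hLc
  have e : 1 / (n : ℝ) * SA - π.real A = (SA - n * π.real A) / n := by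
    field_simp
  rw [e, abs_le, le_div_iff₀ hn', div_le_iff₀ hn']
  constructor <;> nlinarith

/-- Existence of good driver sequences from the union bound over a bracketing. -/
theorem exists_starDiscrepancy_le {d s : ℕ} {G : Set (Fin d → ℝ)} {π ν : Measure G}
    [IsProbabilityMeasure π] [IsProbabilityMeasure ν] {K : Kernel G G} [IsMarkovKernel K]
    (hK : K.IsReversible π) (hν : HasL2Density ν π) {φ : G → Cube s → G} {ψ : Cube s → G}
    (hφ : IsUpdateFunction φ K) (hψ : IsGeneratorFunction ψ ν) {Λ : ℝ}
    (hspec : spectralSup K π hK ≤ Λ) (hΛ : 0 ≤ Λ) (hΛ1 : Λ < 1) {n : ℕ} (hn : 0 < n) {c : ℝ}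
    (hc : 0 ≤ c) (hc1 : c ≤ 1) {k : ℕ} (hk : 0 < k)
    (hsmall : 2 * (k : ℝ) ^ d * (Real.exp 1 * densityNorm ν π *
      Real.exp (-(n * c ^ 2 * ((1 - Λ) / (2 * (1 + Λ)))))) < 1) :
    ∃ u : Fin n → Cube s,
      starDiscrepancy (anchoredBoxes G) π (drivenPoints φ ψ u) ≤ c + d / k := by
  obtain ⟨L, U, hL, hU, hLU, hbr⟩ := exists_brackets_anchoredBoxes G π hk
  set X : ℝ := Real.exp 1 * densityNorm ν π *
      Real.exp (-(n * c ^ 2 * ((1 - Λ) / (2 * (1 + Λ))))) with hX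
  have hX0 : 0 ≤ X := by
    have := one_le_densityNorm hν
    positivity
  set B : Set G → Set (Fin n → Cube s) := fun A => {u | n * c ≤
    ∑ i, (A.indicator (fun _ => (1 : ℝ)) (drivenPoints φ ψ u i) - π.real A)} with hB
  have hBle : ∀ A, MeasurableSet A → volume (B A) ≤ ENNReal.ofReal X := fun A hA =>
    measure_visits_ge_le hK hν hφ hψ hspec hΛ hΛ1 hA hn hc hc1
  have hunion : volume (⋃ i, (B (U i) ∪ B (L i)ᶜ)) < 1 := by
    calc volume (⋃ i, (B (U i) ∪ B (L i)ᶜ))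
        ≤ ∑ i, volume (B (U i) ∪ B (L i)ᶜ) := measure_iUnion_fintype_le _ _
      _ ≤ ∑ _i : Fin d → Fin k, ENNReal.ofReal (2 * X) := by
          refine Finset.sum_le_sum fun i _ => ?_
          refine (measure_union_le _ _).trans ?_
          rw [two_mul, ENNReal.ofReal_add hX0 hX0]
          exact add_le_add (hBle _ (hU i)) (hBle _ (hL i).compl)
      _ = ENNReal.ofReal (2 * (k : ℝ) ^ d * X) := by
          rw [Finset.sum_const, Finset.card_univ, Fintype.card_fun, Fintype.card_fin,
            Fintype.card_fin, nsmul_eq_mul, ← ENNReal.ofReal_natCast,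
            ← ENNReal.ofReal_mul (by positivity)]
          push_cast
          ring_nf
      _ < 1 := by
          rw [← ENNReal.ofReal_one]
          exact (ENNReal.ofReal_lt_ofReal_iff one_pos).2 hsmall
  obtain ⟨u, hu⟩ : ∃ u, u ∉ ⋃ i, (B (U i) ∪ B (L i)ᶜ) := by
    by_contra! h
    rw [Set.eq_univ_of_forall h, measure_univ] at hunion
    exact lt_irrefl _ hunion
  refine ⟨u, Real.iSup_le (fun A => ?_) (by positivity)⟩
  obtain ⟨i, hi1, hi2⟩ := hbr A A.2
  simp only [Set.mem_iUnion, Set.mem_union, not_exists, not_or] at hu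
  exact abs_sub_le_of_bracket π hn _ (hL i) hi1 hi2 (hLU i) (not_le.1 (hu i).1)
    (not_le.1 (hu i).2)

end Discrepancy

/-! ### Numerical constants and the size of the grid. -/

section Constants

/-- These factors are what the union bound leaves over: `2` for the two sets of a bracket, `e` from
the bound on `V`, and `d ^ d` from `k ≤ d n`. The proof uses `2 e < 25`. -/
lemma two_mul_exp_one_mul_pow_lt {d : ℕ} (hd : 1 ≤ d) :
    2 * Real.exp 1 * (d : ℝ) ^ d < Real.exp (3 * (d : ℝ) ^ 2 * Real.log (5 * d)) := by
  have hd' : (1 : ℝ) ≤ d := Nat.one_le_cast.2 hd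
  have h5 : 1 < Real.log 5 := by
    rw [Real.lt_log_iff_exp_lt (by norm_num)]
    linarith [Real.exp_one_lt_d9]
  have hlog : Real.log (5 * d) = Real.log 5 + Real.log d :=
    Real.log_mul (by norm_num) (by positivity)
  have hld : 0 ≤ Real.log d := Real.log_nonneg hd'
  have h1 : Real.log 5 + (d * Real.log d + Real.log 5) ≤
      3 * (d : ℝ) ^ 2 * Real.log (5 * d) := by
    rw [hlog]
    have h2 : (d : ℝ) ≤ (d : ℝ) ^ 2 := by nlinarith
    have h3 : (d : ℝ) * Real.log d ≤ (d : ℝ) ^ 2 * Real.log d := by gcongr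
    have h4 : Real.log 5 ≤ (d : ℝ) ^ 2 * Real.log 5 := by nlinarith
    nlinarith
  refine lt_of_lt_of_le ?_ (Real.exp_le_exp.2 h1)
  rw [Real.exp_add, Real.exp_add, Real.exp_log (by norm_num), ← Real.log_pow,
    Real.exp_log (by positivity)]
  have : (0 : ℝ) < (d : ℝ) ^ d := by positivity
  nlinarith [Real.exp_one_lt_d9]

/-- The witness `⌈d n^(3/4) / 8⌉` makes the bracketing error the second term of the bound, while `k
^ d ≤ (d n) ^ d` costs only `d log n + d log d` in the exponent. -/
lemma exists_grid_size {d n : ℕ} (hd : 1 ≤ d) (hn : 16 ≤ n) :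
    ∃ k : ℕ, 0 < k ∧ (k : ℝ) ≤ d * n ∧ (d : ℝ) / k ≤ 8 / (n : ℝ) ^ (3 / 4 : ℝ) := by
  have hd' : (1 : ℝ) ≤ d := Nat.one_le_cast.2 hd
  have hn' : (16 : ℝ) ≤ n := by exact_mod_cast hn
  set y : ℝ := (n : ℝ) ^ (3 / 4 : ℝ) with hy
  have hy0 : 0 < y := Real.rpow_pos_of_pos (by linarith) _
  have hyn : y ≤ n := by
    calc y ≤ (n : ℝ) ^ (1 : ℝ) := Real.rpow_le_rpow_of_exponent_le (by linarith) (by norm_num)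
      _ = n := Real.rpow_one _
  have hpos : 0 < (d : ℝ) * y / 8 := by positivity
  have hk := Nat.ceil_pos.2 hpos
  refine ⟨⌈(d : ℝ) * y / 8⌉₊, hk, ?_, ?_⟩
  · have h1 := (Nat.ceil_lt_add_one hpos.le).le
    have h2 : (d : ℝ) * y ≤ d * n := by gcongr
    nlinarith
  · have h1 := Nat.le_ceil ((d : ℝ) * y / 8)
    rw [div_le_div_iff₀ (Nat.cast_pos.2 hk) hy0]
    linarith

end Constants

/-! ### Choice of parameters and the rate. -/

/-- The explicit bound, for one `n`. -/
theorem exists_driver_bound {d s : ℕ} (hd : 1 ≤ d) {G : Set (Fin d → ℝ)} {π ν : Measure G}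
    [IsProbabilityMeasure π] [IsProbabilityMeasure ν] {K : Kernel G G} [IsMarkovKernel K]
    (hK : K.IsReversible π) (hν : HasL2Density ν π) {φ : G → Cube s → G} {ψ : Cube s → G}
    (hφ : IsUpdateFunction φ K) (hψ : IsGeneratorFunction ψ ν) {Λ : ℝ}
    (hspec : spectralSup K π hK ≤ Λ) (hΛ : 0 ≤ Λ) (hΛ1 : Λ < 1) {n : ℕ} (hn : 16 ≤ n) :
    ∃ u : Fin n → Cube s,
      starDiscrepancy (anchoredBoxes G) π (drivenPoints φ ψ u) ≤
        √((1 + Λ) / (1 - Λ)) * (√2 * √(Real.log (densityNorm ν π) + d * Real.log n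
          + 3 * (d : ℝ) ^ 2 * Real.log (5 * d)) / √n) + 8 / (n : ℝ) ^ (3 / 4 : ℝ) := by
  have hd' : (1 : ℝ) ≤ d := Nat.one_le_cast.2 hd
  have hn' : (16 : ℝ) ≤ n := by exact_mod_cast hn
  have hn0 : (0 : ℝ) < n := by linarith
  have hD := one_le_densityNorm hν
  have ha : 0 < 1 - Λ := by linarith
  have hb : 0 < 1 + Λ := by linarith
  set D := densityNorm ν π with hDdef
  set M : ℝ := Real.log D + d * Real.log n + 3 * (d : ℝ) ^ 2 * Real.log (5 * d) with hM
  have hM0 : 0 ≤ M := by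
    have h1 := Real.log_nonneg hD
    have h2 : 0 ≤ Real.log n := Real.log_nonneg (by linarith)
    have h3 : 0 ≤ Real.log (5 * d) := Real.log_nonneg (by linarith)
    positivity
  set c : ℝ := √((1 + Λ) / (1 - Λ)) * (√2 * √M / √n) with hc
  have hc0 : 0 ≤ c := by positivity
  have h8 : 0 ≤ 8 / (n : ℝ) ^ (3 / 4 : ℝ) := by positivity
  -- The Hoeffding bound requires `c ≤ 1`; for larger `c` any driver sequence works, because the
  -- discrepancy never exceeds one.
  rcases le_or_gt c 1 with hc1 | hc1
  · obtain ⟨k, hk, hkn, hkd⟩ := exists_grid_size hd hn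
    -- `c` is defined so that the Hoeffding exponent is exactly `M`, and `exp M` exceeds the total
    -- weight `2 k^d e D` of the union bound.
    have hexp : n * c ^ 2 * ((1 - Λ) / (2 * (1 + Λ))) = M := by
      rw [hc, mul_pow, div_pow, mul_pow, Real.sq_sqrt (by positivity), Real.sq_sqrt (by norm_num),
        Real.sq_sqrt hM0, Real.sq_sqrt hn0.le]
      field_simp
    have hsmall : 2 * (k : ℝ) ^ d * (Real.exp 1 * densityNorm ν π *
        Real.exp (-(n * c ^ 2 * ((1 - Λ) / (2 * (1 + Λ)))))) < 1 := by
      rw [hexp, ← hDdef, Real.exp_neg]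
      have hexpM : Real.exp M = D * (n : ℝ) ^ d *
          Real.exp (3 * (d : ℝ) ^ 2 * Real.log (5 * d)) := by
        rw [hM, Real.exp_add, Real.exp_add, Real.exp_log (by linarith), ← Real.log_pow,
          Real.exp_log (by positivity)]
      have hkp : (k : ℝ) ^ d ≤ (d : ℝ) ^ d * (n : ℝ) ^ d := by
        rw [← mul_pow]
        gcongr
      have h1 := two_mul_exp_one_mul_pow_lt hd
      rw [← mul_assoc, ← div_eq_mul_inv, div_lt_one (Real.exp_pos _), hexpM]
      have hDn : 0 < D * (n : ℝ) ^ d := by positivity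
      calc 2 * (k : ℝ) ^ d * (Real.exp 1 * D)
          ≤ 2 * ((d : ℝ) ^ d * (n : ℝ) ^ d) * (Real.exp 1 * D) := by gcongr
        _ = D * (n : ℝ) ^ d * (2 * Real.exp 1 * (d : ℝ) ^ d) := by ring
        _ < _ := by gcongr
    obtain ⟨u, hu⟩ := exists_starDiscrepancy_le hK hν hφ hψ hspec hΛ hΛ1 (by omega) hc0 hc1 hk
      hsmall
    exact ⟨u, hu.trans (by gcongr)⟩
  · exact ⟨fun _ _ => 0, (starDiscrepancy_le_one _ _ _).trans (by linarith)⟩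

/-- The explicit bound is of order `n ^ (-1/2) (log n) ^ (1/2)`. -/
lemma bound_le_rate {ρ C d E : ℝ} (hC : 0 ≤ C) (hd : 0 ≤ d) (hE : 0 ≤ E) {n : ℕ} (hn : 16 ≤ n) :
    √ρ * (√2 * √(C + d * Real.log n + E) / √n) + 8 / (n : ℝ) ^ (3 / 4 : ℝ) ≤
      (√ρ * (√2 * √(C + d + E)) + 8) *
        ((n : ℝ) ^ (-(1 / 2) : ℝ) * (Real.log n) ^ (1 / 2 : ℝ)) := by
  have hn' : (16 : ℝ) ≤ n := by exact_mod_cast hn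
  have hn0 : (0 : ℝ) < n := by linarith
  have hlog : 1 ≤ Real.log n := by
    rw [Real.le_log_iff_exp_le hn0]
    linarith [Real.exp_one_lt_d9]
  rw [Real.rpow_neg hn0.le, ← Real.sqrt_eq_rpow, ← Real.sqrt_eq_rpow, add_mul]
  have hsn : 0 < √(n : ℝ) := Real.sqrt_pos.2 hn0
  refine add_le_add ?_ ?_
  · have h1 : √(C + d * Real.log n + E) ≤ √(C + d + E) * √(Real.log n) := by
      rw [← Real.sqrt_mul (by positivity)]
      refine Real.sqrt_le_sqrt ?_
      nlinarith
    calc √ρ * (√2 * √(C + d * Real.log n + E) / √n)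
        ≤ √ρ * (√2 * (√(C + d + E) * √(Real.log n)) / √n) := by gcongr
      _ = _ := by rw [div_eq_mul_inv]; ring
  · have h1 : √(n : ℝ) ≤ (n : ℝ) ^ (3 / 4 : ℝ) := by
      rw [Real.sqrt_eq_rpow]
      exact Real.rpow_le_rpow_of_exponent_le (by linarith) (by norm_num)
    have h2 : 1 ≤ √(Real.log n) := Real.one_le_sqrt.2 hlog
    calc 8 / (n : ℝ) ^ (3 / 4 : ℝ) ≤ 8 / √(n : ℝ) := by gcongr
      _ = 8 * ((√(n : ℝ))⁻¹ * 1) := by rw [mul_one, div_eq_mul_inv]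
      _ ≤ _ := by gcongr

end MCQMC

theorem mainTheorem2 {d s : ℕ} (hd : 1 ≤ d) (G : Set (Fin d → ℝ)) (hG : Bornology.IsBounded G)
    (π ν : MeasureTheory.Measure G)
    [MeasureTheory.IsProbabilityMeasure π] [MeasureTheory.IsProbabilityMeasure ν]
    (K : ProbabilityTheory.Kernel G G) [ProbabilityTheory.IsMarkovKernel K]
    (hK : K.IsReversible π) (hvb : MCQMC.IsVarianceBounding K π hK)
    (hν : MCQMC.HasL2Density ν π)
    (φ : G → MCQMC.Cube s → G) (hφ : MCQMC.IsUpdateFunction φ K)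
    (ψ : MCQMC.Cube s → G) (hψ : MCQMC.IsGeneratorFunction ψ ν)
    (Λ₀ : ℝ) (hΛ₀ : Λ₀ = max (MCQMC.spectralSup K π hK) 0) :
    (∀ n : ℕ, 16 ≤ n → ∃ u : Fin n → MCQMC.Cube s,
      MCQMC.starDiscrepancy (MCQMC.anchoredBoxes G) π (MCQMC.drivenPoints φ ψ u) ≤
        √((1 + Λ₀) / (1 - Λ₀)) *
          (√2 * √(Real.log (MCQMC.densityNorm ν π) + d * Real.log n
            + 3 * (d : ℝ) ^ 2 * Real.log (5 * d)) / √n)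
        + 8 / (n : ℝ) ^ (3 / 4 : ℝ)) ∧
    ∃ u : (n : ℕ) → Fin n → MCQMC.Cube s,
      (fun n : ℕ =>
        MCQMC.starDiscrepancy (MCQMC.anchoredBoxes G) π (MCQMC.drivenPoints φ ψ (u n)))
        =O[Filter.atTop]
      (fun n : ℕ => (n : ℝ) ^ (-(1 / 2) : ℝ) * (Real.log n) ^ (1 / 2 : ℝ)) := by
  have hspec : MCQMC.spectralSup K π hK ≤ Λ₀ := hΛ₀ ▸ le_max_left _ _
  have hΛ : 0 ≤ Λ₀ := hΛ₀ ▸ le_max_right _ _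
  have hΛ1 : Λ₀ < 1 := hΛ₀ ▸ max_lt hvb one_pos
  have main : ∀ n : ℕ, 16 ≤ n → ∃ u : Fin n → MCQMC.Cube s,
      MCQMC.starDiscrepancy (MCQMC.anchoredBoxes G) π (MCQMC.drivenPoints φ ψ u) ≤
        √((1 + Λ₀) / (1 - Λ₀)) *
          (√2 * √(Real.log (MCQMC.densityNorm ν π) + d * Real.log n
            + 3 * (d : ℝ) ^ 2 * Real.log (5 * d)) / √n)
        + 8 / (n : ℝ) ^ (3 / 4 : ℝ) := fun n hn =>
    MCQMC.exists_driver_bound hd hK hν hφ hψ hspec hΛ hΛ1 hn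
  refine ⟨main, ?_⟩
  -- Lengths below 16 get the zero driver, which is irrelevant as `n → ∞`.
  have hex : ∀ n : ℕ, ∃ u : Fin n → MCQMC.Cube s, 16 ≤ n → _ := fun n =>
    if hn : 16 ≤ n then (main n hn).imp fun _ hu _ => hu
    else ⟨fun _ _ => 0, fun h => absurd h hn⟩
  choose u hu using hex
  refine ⟨u, Asymptotics.IsBigO.of_bound (√((1 + Λ₀) / (1 - Λ₀)) *
    (√2 * √(Real.log (MCQMC.densityNorm ν π) + d
      + 3 * (d : ℝ) ^ 2 * Real.log (5 * d))) + 8) ?_⟩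
  filter_upwards [Filter.eventually_ge_atTop 16] with n hn
  have hd' : (1 : ℝ) ≤ d := Nat.one_le_cast.2 hd
  have hlog : 0 ≤ Real.log n := Real.log_natCast_nonneg n
  have hlog5 : 0 ≤ Real.log (5 * d) := Real.log_nonneg (by linarith)
  rw [Real.norm_of_nonneg (MCQMC.starDiscrepancy_nonneg _ _ _),
    Real.norm_of_nonneg (by positivity)]
  exact (hu n hn).trans (MCQMC.bound_le_rate (Real.log_nonneg (MCQMC.one_le_densityNorm hν))
    (Nat.cast_nonneg d) (by positivity) hn)
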